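/- Let $\mathbb{T}$ be a (many-sorted, relational, first-order) geometric theory, i.e. a set of sequents $\phi \vdash_{\vec x} \psi$ between formulae built from relation symbols and equality using $\top$, $\wedge$, set-indexed $\bigvee$ and $\exists$. *The locale presented by $P[\mathbb{T}]$.* Let $P[\mathbb{T}]$ be the propositional geometric theory with a basic proposition $[n \sim^X m]$ for each sort $X$ and $n,m\in\mathbb{N}$ and a basic proposition $[(n_1,\dots,n_k)\in R]$ for each relation symbol $R \subseteq X^1\times\dots\times X^k$ and $n_1,\dots,n_k\in\mathbb{N}$, and with the axioms: $[n\sim^X m]\vdash[m\sim^X n]$; $[n\sim^X m]\wedge[m\sim^X l]\vdash[n\sim^X l]$; $[\vec n\in R]\wedge\bigwedge_i[n_i\sim^{X^i}m_i]\vdash[\vec m\in R]$; $[\vec n\in R]\vdash\bigwedge_i[n_i\sim^{X^i}n_i]$; and, for each axiom $\phi\vdash_{x_1:X^1,\dots,x_k:X^k}\psi$ of $\mathbb{T}$ and each $\vec n\in\mathbb{N}^k$, $\bigwedge_i[n_i\sim^{X^i}n_i]\wedge\phi_{\vec n}\vdash\psi_{\vec n}$, where $\phi_{\vec n}$ arises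 from $\phi$ by replacing $x_i$ by $n_i$, $\exists x{:}X.\,\chi(x)$ by $\bigvee_{n\in\mathbb{N}}\chi(n)$, $\vec y\in R$ by $[\vec y\in R]$ and $x=_X y$ by $[x\sim^X y]$. The classifying locale of $P[\mathbb{T}]$ is the locale whose frame of opens is presented by the basic propositions as generators and the axioms $\phi\vdash\psi$ as relations $\phi\le\psi$. *The groupoid $G^{\mathbb{T}}$.* Let $\mathbb{T}_{\cong}$ be the theory consisting of two copies of $\mathbb{T}$ (sorts $X_1,X_2$, relation symbols $R_1,R_2$, and both copies of every axiom) together with, for each sort $X$, a relation symbol $\alpha^X\subseteq X_1\times X_2$, axioms saying that $\alpha^X$ is the graph of a bijection, and, for each relation symbol $R$, axioms saying that $\bigwedge_i (x_i,y_i)\in\alpha^{X^i}\wedge\vec x\in R_1$ and $\bigwedge_i (x_i,y_i)\in\alpha^{X^i}\wedge\vec y\in R_2$ are equivalent; let $\mathbb{T}_{\cong,\cong}$ be defined likewise with three copies of $\mathbb{T}$ and two families of relation symbols $\beta^X\subseteq X_1\times X_2$, $\gamma^X\subseteq X_2\times X_3$. Write $[\alpha^X(n)=m]$ for $[(n,m)\in\alpha^X]$.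 Let $G^{\mathbb{T}}_0$, $G^{\mathbb{T}}_1$, $G^{\mathbb{T}}_2$ be the classifying locales of $P[\mathbb{T}]$, $P[\mathbb{T}_{\cong}]$ and $P[\mathbb{T}_{\cong,\cong}]$. Define locale maps through their inverse images on generators, where $a$ ranges over the basic propositions of $P[\mathbb{T}]$ and $a_i$ is its $i$-th copy: $s^*(a)=a_1$; $t^*(a)=a_2$; $e^*(a_1)=e^*(a_2)=a$, $e^*[\alpha^X(n)=m]=[n\sim^X m]$; $i^*(a_1)=a_2$, $i^*(a_2)=a_1$, $i^*[\alpha^X(n)=m]=[\alpha^X(m)=n]$; $\pi_1^*$ and $\pi_2^*\colon \mathcal{O}G^{\mathbb{T}}_1\to\mathcal{O}G^{\mathbb{T}}_2$ pick out $(a_1,a_2,\beta)$ and $(a_2,a_3,\gamma)$; $m^*(a_1)=a_1$, $m^*(a_2)=a_3$, $m^*[\alpha^X(n)=p]=\bigvee_{q\in\mathbb{N}}[\beta^X(n)=q]\wedge[\gamma^X(q)=p]$. **Proposition.** The diagram $G^{\mathbb{T}}$ given by $G^{\mathbb{T}}_0,G^{\mathbb{T}}_1,G^{\mathbb{T}}_2$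 and $s,t,e,i,\pi_1,\pi_2,m$ is an open localic groupoid: $G^{\mathbb{T}}_2$ with $\pi_1,\pi_2$ is the pullback $G^{\mathbb{T}}_1\times_{G^{\mathbb{T}}_0}G^{\mathbb{T}}_1$ of $t$ and $s$, the laws of an internal groupoid in locales hold, and $s$ and $t$ are open locale maps (a locale map $f$ is open if $f^*$ has a left adjoint $f_!$ with $f_!(f^*(u)\wedge v)=u\wedge f_!(v)$ for all opens $u,v$). Moreover, the left adjoint $s_!$ of $s^*$, which satisfies this Frobenius reciprocity condition, is given on basic opens as follows: for all finite sets $I,J$ of basic propositions of $P[\mathbb{T}]$ and every finite set $K$ of triples $(X,c,d)$ of a sort $X$ and $c,d\in\mathbb{N}$, $$s_!\Bigl(\bigwedge_{a\in I}a_1\wedge\bigwedge_{b\in J}b_2\wedge\bigwedge_{(X,c,d)\in K}[\alpha^X(c)=d]\Bigr)=\bigwedge_{a\in I}a\wedge\bigvee_{y\in\mathbb{N}^V}\Bigl(\bigwedge_{b\in J}b(y)\wedge\bigwedge_{(X,c,d)\in K}[c\sim^X y_{(X,d)}]\Bigr),$$ where $V$ is the finite set of pairs $(X,n)$ such that $n$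 occurs in some $b\in J$ at a place of sort $X$, or $(X,c,n)\in K$ for some $c$, and $b(y)$ is $b$ with each $n$ at a place of sort $X$ replaced by $y_{(X,n)}$. -/

import Mathlib

open CategoryTheory

universe u v w

namespace GeomRep

/-! ### Frames presented by generators and relations -/

section Presentation

/-- The free frame on a set of generators: up-closed families of finite sets of generators, ordered
by inclusion. A finite set stands for the formal meet of its elements, a family for the formal join
of its members. -/
abbrev FreeFrame (A : Type u) : Type u := LowerSet (Finset A)ᵒᵈ

/-- The generator `a` as an element of the free frame. -/
def FreeFrame.of {A : Type u} (a : A) : FreeFrame A := LowerSet.Iic (OrderDual.toDual {a})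

variable {A : Type u} {L : Type v} [Order.Frame L]

/-- The extension of a function on generators to a frame homomorphism on the free frame. -/
noncomputable def FreeFrame.lift (g : A → L) : FrameHom (FreeFrame A) L where
  toFun U := ⨆ F : Finset A, ⨆ _ : OrderDual.toDual F ∈ U, F.inf g
  map_inf' U V := by
    classical
    apply le_antisymm
    · refine iSup₂_le fun F hF => le_inf ?_ ?_
      · exact le_iSup₂_of_le F hF.1 le_rfl
      · exact le_iSup₂_of_le F hF.2 le_rfl
    · simp only [iSup_inf_eq, inf_iSup_eq]
      refine iSup₂_le fun F hF => iSup₂_le fun F' hF' => ?_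
      refine le_iSup₂_of_le (F ∪ F') ⟨?_, ?_⟩ (by rw [Finset.inf_union, inf_comm])
      · exact U.lower (OrderDual.toDual_le_toDual.2 Finset.subset_union_right) hF'
      · exact V.lower (OrderDual.toDual_le_toDual.2 Finset.subset_union_left) hF
  map_top' := top_le_iff.1 (le_iSup₂_of_le ∅ trivial (by simp))
  map_sSup' s := by
    apply le_antisymm
    · refine iSup₂_le fun F hF => ?_
      obtain ⟨U, hU, hFU⟩ := LowerSet.mem_sSup_iff.1 hF
      exact le_sSup_of_le ⟨U, hU, rfl⟩ (le_iSup₂_of_le F hFU le_rfl)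
    · refine sSup_le ?_
      rintro _ ⟨U, hU, rfl⟩
      exact iSup₂_le fun F hF => le_iSup₂_of_le F (LowerSet.mem_sSup_iff.2 ⟨U, hU, hF⟩) le_rfl

theorem FreeFrame.lift_of (g : A → L) (a : A) : FreeFrame.lift g (FreeFrame.of a) = g a := by
  apply le_antisymm
  · refine iSup₂_le fun F hF => Finset.inf_le (f := g) ?_
    have h : ({a} : Finset A) ⊆ F := hF
    exact h (Finset.mem_singleton_self a)
  · refine le_iSup₂_of_le {a} (le_refl (OrderDual.toDual ({a} : Finset A))) (by simp)

/-- The quotient of the free frame by the relations `a ≤ b` (for `r a b`), realised as the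
sublocale of those `d` with `(b ⇨ d) ≤ (a ⇨ d)` for every relation `a ≤ b`. -/
def presentedSublocale (r : FreeFrame A → FreeFrame A → Prop) : Sublocale (FreeFrame A) where
  carrier := {d | ∀ a b, r a b → b ⇨ d ≤ a ⇨ d}
  sInf_mem' s hs a b hab := by
    rw [le_himp_iff]
    refine le_sInf fun d hd => ?_
    rw [← le_himp_iff]
    exact (himp_le_himp_left (sInf_le hd)).trans (hs hd a b hab)
  himp_mem' x d hd a b hab := by
    rw [himp_left_comm b, himp_left_comm a]
    exact himp_le_himp_left (hd a b hab)

/-- The frame presented by generators `A` and relations `r`. -/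
def Presented (r : FreeFrame A → FreeFrame A → Prop) : Type u := ↥(presentedSublocale r)

noncomputable instance (r : FreeFrame A → FreeFrame A → Prop) : Order.Frame (Presented r) :=
  inferInstanceAs (Order.Frame ↥(presentedSublocale r))

namespace Presented

variable {r : FreeFrame A → FreeFrame A → Prop}

/-- The quotient map from the free frame. -/
noncomputable def mk (r : FreeFrame A → FreeFrame A → Prop) : FrameHom (FreeFrame A) (Presented r) :=
  (presentedSublocale r).restrict

/-- The generator `a` as an element of the presented frame. -/
noncomputable def of (r : FreeFrame A → FreeFrame A → Prop) (a : A) : Presented r := mk r (FreeFrame.of a)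

/-- The inclusion of the presented frame, a sublocale, into the free frame. -/
def val (d : Presented r) : FreeFrame A := Subtype.val (p := (· ∈ presentedSublocale r)) d

theorem mk_le_iff {x : FreeFrame A} {d : Presented r} : mk r x ≤ d ↔ x ≤ d.val :=
  (presentedSublocale r).giRestrict.gc x d

theorem mk_le_mk {a b : FreeFrame A} (h : r a b) : mk r a ≤ mk r b := by
  rw [mk_le_iff]
  have h1 : b ≤ (mk r b).val := mk_le_iff.1 le_rfl
  have h2 : b ⇨ (mk r b).val ≤ a ⇨ (mk r b).val :=
    Subtype.property (p := (· ∈ presentedSublocale r)) (mk r b) a b h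
  rw [himp_eq_top_iff.2 h1, top_le_iff, himp_eq_top_iff] at h2
  exact h2

theorem mk_val (d : Presented r) : mk r d.val = d := (presentedSublocale r).giRestrict.l_u_eq d

theorem freeLift_mk (g : A → L)
    (h : ∀ a b, r a b → FreeFrame.lift g a ≤ FreeFrame.lift g b) (x : FreeFrame A) :
    FreeFrame.lift g (mk r x).val = FreeFrame.lift g x := by
  have gc : GaloisConnection (FreeFrame.lift g) (fun z => sSup {y | FreeFrame.lift g y ≤ z}) := by
    intro y z
    refine ⟨fun hy => le_sSup hy, fun hy => ?_⟩
    refine (OrderHomClass.mono (FreeFrame.lift g) hy).trans ?_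
    rw [map_sSup]
    exact sSup_le (by rintro _ ⟨y, hy, rfl⟩; exact hy)
  apply le_antisymm
  · have hmem : sSup {y | FreeFrame.lift g y ≤ FreeFrame.lift g x} ∈ presentedSublocale r := by
      intro a b hab
      rw [le_himp_iff, ← gc, map_inf]
      refine (inf_le_inf_left _ (h a b hab)).trans ?_
      rw [← map_inf, gc]
      exact himp_inf_le
    rw [gc]
    exact (mk_le_iff (d := (⟨_, hmem⟩ : presentedSublocale r))).2 (le_sSup le_rfl)
  · exact OrderHomClass.mono (FreeFrame.lift g) (mk_le_iff.1 le_rfl)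

/-- A function on generators whose extension to the free frame respects the relations induces a
frame homomorphism on the presented frame. -/
noncomputable def lift (g : A → L)
    (h : ∀ a b, r a b → FreeFrame.lift g a ≤ FreeFrame.lift g b) : FrameHom (Presented r) L where
  toFun d := FreeFrame.lift g d.val
  map_inf' d d' := map_inf (FreeFrame.lift g) d.val d'.val
  map_top' := map_top (FreeFrame.lift g)
  map_sSup' s := by
    have hs : sSup s = mk r (sSup (val '' s)) := by
      rw [map_sSup, Set.image_image]
      simp [mk_val]
    rw [hs, freeLift_mk g h, map_sSup, Set.image_image]

theorem lift_of (g : A → L) (h : ∀ a b, r a b → FreeFrame.lift g a ≤ FreeFrame.lift g b) (a : A) :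
    lift g h (of r a) = g a :=
  (freeLift_mk g h _).trans (FreeFrame.lift_of g a)

end Presented

end Presentation

/-! ### Geometric theories -/

/-- A many-sorted relational signature. -/
structure Signature where
  Sorts : Type u
  Rels : Type u
  arity : Rels → ℕ
  dom : (R : Rels) → Fin (arity R) → Sorts

/-- Geometric formulae over `S` whose free variables are among `n` given variables. Under an
existential quantifier the bound variable gets index `0` and the others are shifted by one. -/
inductive Formula (S : Signature.{u}) : ℕ → Type (u + 1)
  | rel {n : ℕ} (R : S.Rels) (x : Fin (S.arity R) → Fin n) : Formula S n
  | eq {n : ℕ} (X : S.Sorts) (x y : Fin n) : Formula S n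
  | top {n : ℕ} : Formula S n
  | and {n : ℕ} (φ ψ : Formula S n) : Formula S n
  | disj {n : ℕ} {I : Type u} (φ : I → Formula S n) : Formula S n
  | ex {n : ℕ} (X : S.Sorts) (φ : Formula S (n + 1)) : Formula S n

namespace Formula

variable {S : Signature.{u}}

/-- The formula is well typed in the context that gives the variable `i` the sort `Γ i`. -/
def WellTyped : {n : ℕ} → Formula S n → (Fin n → S.Sorts) → Prop
  | _, rel R x, Γ => ∀ i, Γ (x i) = S.dom R i
  | _, eq X x y, Γ => Γ x = X ∧ Γ y = X
  | _, top, _ => True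
  | _, and φ ψ, Γ => φ.WellTyped Γ ∧ ψ.WellTyped Γ
  | _, disj φ, Γ => ∀ i, (φ i).WellTyped Γ
  | _, ex X φ, Γ => φ.WellTyped (Fin.cons X Γ : Fin (_ + 1) → S.Sorts)

/-- The finite conjunction `φ 0 ∧ ⋯ ∧ φ (k - 1)`. -/
def conj {n : ℕ} : {k : ℕ} → (Fin k → Formula S n) → Formula S n
  | 0, _ => top
  | _ + 1, φ => and (φ 0) (conj fun i => φ i.succ)

theorem conj_wellTyped {n : ℕ} {Γ : Fin n → S.Sorts} : {k : ℕ} → {φ : Fin k → Formula S n} →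
    (∀ i, (φ i).WellTyped Γ) → (conj φ).WellTyped Γ
  | 0, _, _ => trivial
  | _ + 1, _, h => ⟨h 0, conj_wellTyped fun i => h i.succ⟩

end Formula

/-- A sequent `lhs ⊢ rhs` in the context `ctx`. -/
structure Sequent (S : Signature.{u}) where
  n : ℕ
  ctx : Fin n → S.Sorts
  lhs : Formula S n
  rhs : Formula S n
  lhs_wellTyped : lhs.WellTyped ctx
  rhs_wellTyped : rhs.WellTyped ctx

/-- A first-order geometric theory. -/
structure Theory where
  sig : Signature.{u}
  axioms : Set (Sequent sig)

/-! ### The propositional theory `P[T]` and its classifying locale -/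

/-- The basic propositions of `P[T]`: `eqv X n m` is `[n ∼^X m]` and `rel R n` is
`[(n₁, …, n_k) ∈ R]`. -/
inductive Basic (S : Signature.{u}) : Type u
  | eqv (X : S.Sorts) (n m : ℕ) : Basic S
  | rel (R : S.Rels) (n : Fin (S.arity R) → ℕ) : Basic S

section

variable {S : Signature.{u}} {L : Type v} [Order.Frame L]

/-- The propositional formula `φ_n` obtained from `φ` by substituting the natural number `n i` for
the variable `i`, equality by `∼` and each existential quantifier by a join over `ℕ`, evaluated in a
frame in which the basic propositions have the values `g`. -/
def Formula.eval (g : Basic S → L) : {n : ℕ} → Formula S n → (Fin n → ℕ) → L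
  | _, rel R x, ρ => g (.rel R fun i => ρ (x i))
  | _, eq X x y, ρ => g (.eqv X (ρ x) (ρ y))
  | _, top, _ => ⊤
  | _, and φ ψ, ρ => φ.eval g ρ ⊓ ψ.eval g ρ
  | _, disj φ, ρ => ⨆ i, (φ i).eval g ρ
  | _, ex _ φ, ρ => ⨆ m : ℕ, φ.eval g (Fin.cons m ρ : Fin (_ + 1) → ℕ)

/-- `[n₁ ∼ m₁] ∧ ⋯ ∧ [n_k ∼ m_k]` for tuples of sorts `Γ`. -/
def eqvAll (g : Basic S → L) {k : ℕ} (Γ : Fin k → S.Sorts) (n m : Fin k → ℕ) : L :=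
  Finset.univ.inf fun i => g (.eqv (Γ i) (n i) (m i))

end

/-- The axioms of `P[T]`, as pairs `(a, b)` standing for `a ⊢ b`, with the basic propositions
evaluated by `g` in a frame `L`. -/
inductive PAxiom (T : Theory.{u}) {L : Type v} [Order.Frame L] (g : Basic T.sig → L) : L → L → Prop
  | symm (X : T.sig.Sorts) (n m : ℕ) : PAxiom T g (g (.eqv X n m)) (g (.eqv X m n))
  | trans (X : T.sig.Sorts) (n m l : ℕ) :
      PAxiom T g (g (.eqv X n m) ⊓ g (.eqv X m l)) (g (.eqv X n l))
  | congr (R : T.sig.Rels) (n m : Fin (T.sig.arity R) → ℕ) :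
      PAxiom T g (g (.rel R n) ⊓ eqvAll g (T.sig.dom R) n m) (g (.rel R m))
  | strict (R : T.sig.Rels) (n : Fin (T.sig.arity R) → ℕ) :
      PAxiom T g (g (.rel R n)) (eqvAll g (T.sig.dom R) n n)
  | ax (σ : Sequent T.sig) (hσ : σ ∈ T.axioms) (n : Fin σ.n → ℕ) :
      PAxiom T g (eqvAll g σ.ctx n n ⊓ σ.lhs.eval g n) (σ.rhs.eval g n)

/-- An interpretation of the basic propositions in a frame is a model of `P[T]` if it validates all
axioms. -/
def IsModel (T : Theory.{u}) {L : Type v} [Order.Frame L] (g : Basic T.sig → L) : Prop :=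
  ∀ a b, PAxiom T g a b → a ≤ b

/-- The frame of opens of the classifying locale of `P[T]`: it is presented by the basic
propositions as generators and the axioms as relations. -/
abbrev Opens (T : Theory.{u}) : Type u :=
  Presented (A := Basic T.sig) (PAxiom T (FreeFrame.of (A := Basic T.sig)))

/-- A basic proposition as an element of the frame presented by `P[T]`. -/
noncomputable def Opens.of (T : Theory.{u}) (a : Basic T.sig) : Opens T := Presented.of _ a

section

variable {L : Type v} [Order.Frame L] {M : Type w} [Order.Frame M]

theorem Formula.map_eval {S : Signature.{u}} (f : FrameHom L M) (g : Basic S → L) :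
    {n : ℕ} → (φ : Formula S n) → (ρ : Fin n → ℕ) →
    f (φ.eval g ρ) = φ.eval (fun a => f (g a)) ρ
  | _, rel R x, ρ => rfl
  | _, eq X x y, ρ => rfl
  | _, top, _ => map_top f
  | _, and φ ψ, ρ => by simp only [eval, map_inf, map_eval f g φ, map_eval f g ψ]
  | _, disj φ, ρ => by simp only [eval, map_iSup, fun i => map_eval f g (φ i)]
  | _, ex _ φ, ρ => by simp only [eval, map_iSup, map_eval f g φ]

theorem map_eqvAll {S : Signature.{u}} (f : FrameHom L M) (g : Basic S → L) {k : ℕ}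
    (Γ : Fin k → S.Sorts) (n m : Fin k → ℕ) :
    f (eqvAll g Γ n m) = eqvAll (fun x => f (g x)) Γ n m := by
  simp only [eqvAll, map_finset_inf, Function.comp_def]

theorem PAxiom.map {T : Theory.{u}} (f : FrameHom L M) {g : Basic T.sig → L} {a b : L}
    (h : PAxiom T g a b) : PAxiom T (fun x => f (g x)) (f a) (f b) := by
  cases h with
  | symm X n m => exact .symm X n m
  | trans X n m l => rw [map_inf]; exact .trans X n m l
  | congr R n m => rw [map_inf, map_eqvAll]; exact .congr R n m
  | strict R n => rw [map_eqvAll]; exact .strict R n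
  | ax σ hσ n => rw [map_inf, map_eqvAll, Formula.map_eval, Formula.map_eval]; exact .ax σ hσ n

/-- The frame homomorphism from the frame presented by `P[T]` that corresponds to a model. -/
noncomputable def Opens.lift {T : Theory.{u}} (g : Basic T.sig → L) (h : IsModel T g) :
    FrameHom (Opens T) L :=
  Presented.lift g fun a b hab => h _ _ (by
    simpa only [FreeFrame.lift_of] using hab.map (FreeFrame.lift g))

theorem Opens.lift_of {T : Theory.{u}} (g : Basic T.sig → L) (h : IsModel T g)
    (a : Basic T.sig) : Opens.lift g h (Opens.of T a) = g a := Presented.lift_of _ _ _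

theorem Opens.isModel_of (T : Theory.{u}) : IsModel T (Opens.of T) := by
  intro a b h
  cases h with
  | symm X n m => exact Presented.mk_le_mk (.symm X n m)
  | trans X n m l =>
    have h := Presented.mk_le_mk (PAxiom.trans (T := T) (g := FreeFrame.of) X n m l)
    simp only [map_inf] at h
    exact h
  | congr R n m =>
    have h := Presented.mk_le_mk (PAxiom.congr (T := T) (g := FreeFrame.of) R n m)
    simp only [map_inf, map_eqvAll] at h
    exact h
  | strict R n =>
    have h := Presented.mk_le_mk (PAxiom.strict (T := T) (g := FreeFrame.of) R n)
    simp only [map_eqvAll] at h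
    exact h
  | ax σ hσ n =>
    have h := Presented.mk_le_mk (PAxiom.ax (T := T) (g := FreeFrame.of) σ hσ n)
    simp only [map_inf, map_eqvAll, Formula.map_eval] at h
    exact h

end

/-! ### The theory of chains of isomorphisms of `T`-models -/

section Chain

/-- The signature with `k + 1` copies of the sorts and relation symbols of `S`, and a relation
symbol `α_j^X ⊆ X_j × X_{j+1}` for each sort `X` and each `j < k`. -/
def chainSig (S : Signature.{u}) (k : ℕ) : Signature.{u} where
  Sorts := S.Sorts × Fin (k + 1)
  Rels := (S.Rels × Fin (k + 1)) ⊕ (S.Sorts × Fin k)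
  arity
    | .inl (R, _) => S.arity R
    | .inr _ => 2
  dom
    | .inl (R, i) => fun a => (S.dom R a, i)
    | .inr (X, j) => ![(X, j.castSucc), (X, j.succ)]

variable {S : Signature.{u}} {k : ℕ}

/-- The `i`-th copy of a formula. -/
def Formula.copy (i : Fin (k + 1)) : {n : ℕ} → Formula S n → Formula (chainSig S k) n
  | _, rel R x => rel (S := chainSig S k) (.inl (R, i)) x
  | _, eq X x y => eq (S := chainSig S k) (X, i) x y
  | _, top => top
  | _, and φ ψ => and (φ.copy i) (ψ.copy i)
  | _, disj φ => disj fun a => (φ a).copy i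
  | _, ex X φ => ex (S := chainSig S k) (X, i) (φ.copy i)

theorem Formula.copy_wellTyped (i : Fin (k + 1)) : {n : ℕ} → {φ : Formula S n} →
    {Γ : Fin n → S.Sorts} → φ.WellTyped Γ →
    (φ.copy i).WellTyped (fun a => ((Γ a, i) : S.Sorts × Fin (k + 1)))
  | _, rel _ _, _, h => fun a => congrArg (fun X => (X, i)) (h a)
  | _, eq _ _ _, _, h => ⟨congrArg (fun X => (X, i)) h.1, congrArg (fun X => (X, i)) h.2⟩
  | _, top, _, _ => trivial
  | _, and _ _, _, h => ⟨copy_wellTyped i h.1, copy_wellTyped i h.2⟩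
  | _, disj _, _, h => fun a => copy_wellTyped i (h a)
  | _, ex X φ, Γ, h => by
    have := copy_wellTyped i (φ := φ) h
    have e : (fun a => (((Fin.cons X Γ : Fin (_ + 1) → S.Sorts) a, i) : S.Sorts × Fin (k + 1))) =
        (Fin.cons (X, i) (fun a => (Γ a, i)) : Fin (_ + 1) → S.Sorts × Fin (k + 1)) := by
      funext a
      refine Fin.cases rfl (fun a => rfl) a
    rw [e] at this
    exact this

/-- The `i`-th copy of a sequent. -/
def Sequent.copy (i : Fin (k + 1)) (σ : Sequent S) : Sequent (chainSig S k) where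
  n := σ.n
  ctx a := (σ.ctx a, i)
  lhs := σ.lhs.copy i
  rhs := σ.rhs.copy i
  lhs_wellTyped := Formula.copy_wellTyped i σ.lhs_wellTyped
  rhs_wellTyped := Formula.copy_wellTyped i σ.rhs_wellTyped

/-- The atomic formula `(x, y) ∈ α_j^X`. -/
def Formula.iso (X : S.Sorts) (j : Fin k) {n : ℕ} (x y : Fin n) : Formula (chainSig S k) n :=
  rel (S := chainSig S k) (.inr (X, j)) ![x, y]

theorem Formula.iso_wellTyped {X : S.Sorts} {j : Fin k} {n : ℕ} {x y : Fin n}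
    {Γ : Fin n → S.Sorts × Fin (k + 1)} (hx : Γ x = (X, j.castSucc)) (hy : Γ y = (X, j.succ)) :
    (Formula.iso X j x y).WellTyped Γ := fun a => by
  change Fin 2 at a
  fin_cases a
  · exact hx
  · exact hy

/-- The context `x x' : X_j, y y' : X_{j+1}`. -/
def graphCtx (X : S.Sorts) (j : Fin k) : Fin 4 → (chainSig S k).Sorts :=
  ![(X, j.castSucc), (X, j.castSucc), (X, j.succ), (X, j.succ)]

/-- `(x, y) ∈ α ∧ (x', y') ∈ α ∧ x = x' ⊢ (x, y) ∈ α ∧ (x', y') ∈ α ∧ y = y'`. -/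
def functionality (X : S.Sorts) (j : Fin k) : Sequent (chainSig S k) where
  n := 4
  ctx := graphCtx X j
  lhs := .and (.iso X j 0 2) (.and (.iso X j 1 3) (.eq (S := chainSig S k) (X, j.castSucc) 0 1))
  rhs := .and (.iso X j 0 2) (.and (.iso X j 1 3) (.eq (S := chainSig S k) (X, j.succ) 2 3))
  lhs_wellTyped := ⟨Formula.iso_wellTyped rfl rfl, Formula.iso_wellTyped rfl rfl, rfl, rfl⟩
  rhs_wellTyped := ⟨Formula.iso_wellTyped rfl rfl, Formula.iso_wellTyped rfl rfl, rfl, rfl⟩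

/-- `(x, y) ∈ α ∧ (x', y') ∈ α ∧ y = y' ⊢ (x, y) ∈ α ∧ (x', y') ∈ α ∧ x = x'`. -/
def injectivity (X : S.Sorts) (j : Fin k) : Sequent (chainSig S k) where
  n := 4
  ctx := graphCtx X j
  lhs := (functionality X j).rhs
  rhs := (functionality X j).lhs
  lhs_wellTyped := (functionality X j).rhs_wellTyped
  rhs_wellTyped := (functionality X j).lhs_wellTyped

/-- `⊢_{x : X_j} ∃ y : X_{j+1}. (x, y) ∈ α`; the bound variable `y` has index `0`. -/
def totality (X : S.Sorts) (j : Fin k) : Sequent (chainSig S k) where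
  n := 1
  ctx := fun _ => (X, j.castSucc)
  lhs := .top
  rhs := .ex (S := chainSig S k) (X, j.succ) (.iso X j 1 0)
  lhs_wellTyped := trivial
  rhs_wellTyped := Formula.iso_wellTyped rfl rfl

/-- `⊢_{y : X_{j+1}} ∃ x : X_j. (x, y) ∈ α`; the bound variable `x` has index `0`. -/
def surjectivity (X : S.Sorts) (j : Fin k) : Sequent (chainSig S k) where
  n := 1
  ctx := fun _ => (X, j.succ)
  lhs := .top
  rhs := .ex (S := chainSig S k) (X, j.castSucc) (.iso X j 0 1)
  lhs_wellTyped := trivial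
  rhs_wellTyped := Formula.iso_wellTyped rfl rfl

/-- The context `x₁ : X¹_j, …, x_a : Xᵃ_j, y₁ : X¹_{j+1}, …, y_a : Xᵃ_{j+1}` where
`X¹ × ⋯ × Xᵃ` is the arity of `R`. -/
def relCtx (R : S.Rels) (j : Fin k) : Fin (S.arity R + S.arity R) → (chainSig S k).Sorts :=
  Fin.append (fun a => (S.dom R a, j.castSucc)) (fun a => (S.dom R a, j.succ))

/-- `⋀ (x_i, y_i) ∈ α ∧ (x₁, …, x_a) ∈ R_j ⊢ ⋀ (x_i, y_i) ∈ α ∧ (y₁, …, y_a) ∈ R_{j+1}`. -/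
def preservation (R : S.Rels) (j : Fin k) : Sequent (chainSig S k) where
  n := S.arity R + S.arity R
  ctx := relCtx R j
  lhs := .and (.conj fun a => .iso (S.dom R a) j (Fin.castAdd _ a) (Fin.natAdd _ a))
    (.rel (S := chainSig S k) (.inl (R, j.castSucc)) fun a => Fin.castAdd _ a)
  rhs := .and (.conj fun a => .iso (S.dom R a) j (Fin.castAdd _ a) (Fin.natAdd _ a))
    (.rel (S := chainSig S k) (.inl (R, j.succ)) fun a => Fin.natAdd _ a)
  lhs_wellTyped := ⟨Formula.conj_wellTyped fun _ => Formula.iso_wellTyped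
    (Fin.append_left _ _ _) (Fin.append_right _ _ _), fun _ => Fin.append_left _ _ _⟩
  rhs_wellTyped := ⟨Formula.conj_wellTyped fun _ => Formula.iso_wellTyped
    (Fin.append_left _ _ _) (Fin.append_right _ _ _), fun _ => Fin.append_right _ _ _⟩

/-- The converse of `preservation`. -/
def reflection (R : S.Rels) (j : Fin k) : Sequent (chainSig S k) where
  n := S.arity R + S.arity R
  ctx := relCtx R j
  lhs := (preservation R j).rhs
  rhs := (preservation R j).lhs
  lhs_wellTyped := (preservation R j).rhs_wellTyped
  rhs_wellTyped := (preservation R j).lhs_wellTyped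

/-- The axioms of the theory of chains of `k` isomorphisms of `T`-models. -/
inductive ChainAxiom (T : Theory.{u}) (k : ℕ) : Sequent (chainSig T.sig k) → Prop
  | copy (i : Fin (k + 1)) (σ : Sequent T.sig) (hσ : σ ∈ T.axioms) : ChainAxiom T k (σ.copy i)
  | functionality (X : T.sig.Sorts) (j : Fin k) : ChainAxiom T k (functionality X j)
  | injectivity (X : T.sig.Sorts) (j : Fin k) : ChainAxiom T k (injectivity X j)
  | totality (X : T.sig.Sorts) (j : Fin k) : ChainAxiom T k (totality X j)
  | surjectivity (X : T.sig.Sorts) (j : Fin k) : ChainAxiom T k (surjectivity X j)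
  | preservation (R : T.sig.Rels) (j : Fin k) : ChainAxiom T k (preservation R j)
  | reflection (R : T.sig.Rels) (j : Fin k) : ChainAxiom T k (reflection R j)

/-- The theory of `k + 1` models of `T` and `k` isomorphisms
`M_0 ≅ M_1 ≅ ⋯ ≅ M_k` between consecutive ones. -/
abbrev chain (T : Theory.{u}) (k : ℕ) : Theory.{u} where
  sig := chainSig T.sig k
  axioms := {σ | ChainAxiom T k σ}

/-- The theory `T_≅` of isomorphisms of `T`-models. -/
abbrev isoTheory (T : Theory.{u}) : Theory.{u} := chain T 1

/-- The theory `T_{≅,≅}` of composable pairs of isomorphisms of `T`-models. -/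
abbrev isoPairTheory (T : Theory.{u}) : Theory.{u} := chain T 2

/-- The `i`-th copy of a basic proposition. -/
def Basic.copy (i : Fin (k + 1)) : Basic S → Basic (chainSig S k)
  | eqv X n m => eqv (S := chainSig S k) (X, i) n m
  | rel R n => rel (S := chainSig S k) (.inl (R, i)) n

/-- The basic proposition `[α_j^X(n) = m]`, that is `[(n, m) ∈ α_j^X]`. -/
def Basic.iso (j : Fin k) (X : S.Sorts) (n m : ℕ) : Basic (chainSig S k) :=
  rel (S := chainSig S k) (.inr (X, j)) ![n, m]

/-- An assignment of values to all basic propositions of the chain theory, from the values `g i`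
on the `i`-th copy and the values `α j` on the `j`-th isomorphism. -/
def Basic.glue {L : Type v} (g : Fin (k + 1) → Basic S → L) (α : Fin k → S.Sorts → ℕ → ℕ → L) :
    Basic (chainSig S k) → L
  | eqv (X, i) n m => g i (eqv X n m)
  | rel (.inl (R, i)) n => g i (rel R n)
  | rel (.inr (X, j)) n => α j X (n (0 : Fin 2)) (n (1 : Fin 2))

/-- The values `α` make the models `g` and `g'` of `P[T]` isomorphic: this spells out the axioms for
one isomorphism of the chain theory in a frame. -/
structure IsIsoRel {L : Type v} [Order.Frame L] (g g' : Basic S → L) (α : S.Sorts → ℕ → ℕ → L) :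
    Prop where
  dom_le : ∀ X n m, α X n m ≤ g (.eqv X n n)
  cod_le : ∀ X n m, α X n m ≤ g' (.eqv X m m)
  congr : ∀ X n m n' m', α X n m ⊓ g (.eqv X n n') ⊓ g' (.eqv X m m') ≤ α X n' m'
  func : ∀ X n n' m m', α X n m ⊓ α X n' m' ⊓ g (.eqv X n n') ≤ g' (.eqv X m m')
  inj : ∀ X n n' m m', α X n m ⊓ α X n' m' ⊓ g' (.eqv X m m') ≤ g (.eqv X n n')
  total : ∀ X n, g (.eqv X n n) ≤ ⨆ m, α X n m
  surj : ∀ X m, g' (.eqv X m m) ≤ ⨆ n, α X n m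
  pres : ∀ (R : S.Rels) (n m : Fin (S.arity R) → ℕ),
    (Finset.univ.inf fun a => α (S.dom R a) (n a) (m a)) ⊓ g (.rel R n) ≤ g' (.rel R m)
  refl : ∀ (R : S.Rels) (n m : Fin (S.arity R) → ℕ),
    (Finset.univ.inf fun a => α (S.dom R a) (n a) (m a)) ⊓ g' (.rel R m) ≤ g (.rel R n)

variable {L : Type v} [Order.Frame L]

theorem Formula.eval_copy (i : Fin (k + 1)) (g : Basic (chainSig S k) → L) :
    {n : ℕ} → (φ : Formula S n) → (ρ : Fin n → ℕ) →
    (φ.copy i).eval g ρ = φ.eval (fun a => g (a.copy i)) ρ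
  | _, rel R x, ρ => rfl
  | _, eq X x y, ρ => rfl
  | _, top, _ => rfl
  | _, and φ ψ, ρ => by simp only [eval, copy, eval_copy i g φ, eval_copy i g ψ]
  | _, disj φ, ρ => by simp only [eval, copy, fun a => eval_copy i g (φ a)]
  | _, ex _ φ, ρ => by simp only [eval, copy, eval_copy i g φ]

theorem Formula.eval_conj (g : Basic S → L) {n : ℕ} (ρ : Fin n → ℕ) :
    {k : ℕ} → (φ : Fin k → Formula S n) →
    (conj φ).eval g ρ = Finset.univ.inf fun i => (φ i).eval g ρ
  | 0, _ => by simp [conj, eval]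
  | _ + 1, φ => by
    rw [Fin.univ_succ, Finset.inf_cons, Finset.inf_map]
    simp only [conj, eval, eval_conj g ρ (fun i => φ i.succ)]
    rfl

theorem Formula.eval_iso (g : Basic (chainSig S k) → L) (X : S.Sorts) (j : Fin k) {n : ℕ}
    (x y : Fin n) (ρ : Fin n → ℕ) : (iso X j x y).eval g ρ = g (.iso j X (ρ x) (ρ y)) := by
  have : (fun i => ρ ((![x, y] : Fin 2 → Fin n) i)) = ![ρ x, ρ y] := by
    funext i; fin_cases i <;> rfl
  exact congrArg (fun v => g (.rel (S := chainSig S k) (.inr (X, j)) v)) this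

variable {T : Theory.{u}}

theorem IsModel.copy {g : Basic (chain T k).sig → L} (h : IsModel (chain T k) g) (i : Fin (k + 1)) :
    IsModel T fun a => g (a.copy i) := by
  intro a b hab
  cases hab with
  | symm X n m => exact h _ _ (.symm (T := chain T k) (X, i) n m)
  | trans X n m l => exact h _ _ (.trans (T := chain T k) (X, i) n m l)
  | congr R n m => exact h _ _ (.congr (T := chain T k) (.inl (R, i)) n m)
  | strict R n => exact h _ _ (.strict (T := chain T k) (.inl (R, i)) n)
  | ax σ hσ n =>
    rw [← Formula.eval_copy, ← Formula.eval_copy]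
    exact h _ _ (.ax (T := chain T k) (σ.copy i) (.copy i σ hσ) n)

theorem IsModel.isIsoRel {g : Basic (chain T k).sig → L} (h : IsModel (chain T k) g) (j : Fin k) :
    IsIsoRel (fun a => g (a.copy j.castSucc)) (fun a => g (a.copy j.succ))
      (fun X n m => g (.iso j X n m)) := by
  have hdom : ∀ X n m, g (.iso j X n m) ≤ g ((Basic.eqv X n n).copy j.castSucc) := fun X n m =>
    (h _ _ (.strict (T := chain T k) (.inr (X, j)) ![n, m])).trans
      (Finset.inf_le (Finset.mem_univ (0 : Fin 2)))
  have hcod : ∀ X n m, g (.iso j X n m) ≤ g ((Basic.eqv X m m).copy j.succ) := fun X n m =>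
    (h _ _ (.strict (T := chain T k) (.inr (X, j)) ![n, m])).trans
      (Finset.inf_le (Finset.mem_univ (1 : Fin 2)))
  have hctx : ∀ X n n' m m', g (.iso j X n m) ⊓ g (.iso j X n' m') ≤
      eqvAll g (graphCtx X j) ![n, n', m, m'] ![n, n', m, m'] := fun X n n' m m' =>
    Finset.le_inf fun a _ => by
      fin_cases a
      · exact inf_le_left.trans (hdom X n m)
      · exact inf_le_right.trans (hdom X n' m')
      · exact inf_le_left.trans (hcod X n m)
      · exact inf_le_right.trans (hcod X n' m')
  have hrel : ∀ (R : T.sig.Rels) (n m : Fin (T.sig.arity R) → ℕ),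
      (Finset.univ.inf fun a => g (.iso j (T.sig.dom R a) (n a) (m a))) ≤
      eqvAll g (relCtx R j) (Fin.append n m) (Fin.append n m) := fun R n m =>
    Finset.le_inf fun a _ => by
      refine Fin.addCases (fun a => ?_) (fun a => ?_) a
      · have e : relCtx (k := k) R j (Fin.castAdd _ a) = (T.sig.dom R a, j.castSucc) :=
          Fin.append_left _ _ _
        rw [e, Fin.append_left]
        exact (Finset.inf_le (Finset.mem_univ a)).trans (hdom _ _ (m a))
      · have e : relCtx (k := k) R j (Fin.natAdd _ a) = (T.sig.dom R a, j.succ) :=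
          Fin.append_right _ _ _
        rw [e, Fin.append_right]
        exact (Finset.inf_le (Finset.mem_univ a)).trans (hcod _ (n a) _)
  refine ⟨hdom, hcod, ?_, ?_, ?_, ?_, ?_, ?_, ?_⟩
  · intro X n m n' m'
    refine le_trans ?_ (h _ _ (.congr (T := chain T k) (.inr (X, j)) ![n, m] ![n', m']))
    rw [inf_assoc]
    refine inf_le_inf_left _ (Finset.le_inf fun a _ => ?_)
    change Fin 2 at a
    fin_cases a
    · exact inf_le_left
    · exact inf_le_right
  · intro X n n' m m'
    have := h _ _ (.ax (T := chain T k) (functionality X j) (.functionality X j) ![n, n', m, m'])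
    simp only [functionality, Formula.eval, Formula.eval_iso] at this
    refine le_trans (le_inf (inf_le_left.trans (hctx X n n' m m')) ?_)
      (this.trans (inf_le_right.trans inf_le_right))
    rw [inf_assoc]
    exact le_rfl
  · intro X n n' m m'
    have := h _ _ (.ax (T := chain T k) (injectivity X j) (.injectivity X j) ![n, n', m, m'])
    simp only [injectivity, functionality, Formula.eval, Formula.eval_iso] at this
    refine le_trans (le_inf (inf_le_left.trans (hctx X n n' m m')) ?_)
      (this.trans (inf_le_right.trans inf_le_right))
    rw [inf_assoc]
    exact le_rfl
  · intro X n
    have := h _ _ (.ax (T := chain T k) (totality X j) (.totality X j) fun _ => n)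
    simp only [totality, Formula.eval, Formula.eval_iso] at this
    exact le_trans (le_inf (Finset.le_inf fun a _ => le_rfl) le_top) this
  · intro X n
    have := h _ _ (.ax (T := chain T k) (surjectivity X j) (.surjectivity X j) fun _ => n)
    simp only [surjectivity, Formula.eval, Formula.eval_iso] at this
    exact le_trans (le_inf (Finset.le_inf fun a _ => le_rfl) le_top) this
  · intro R n m
    have := h _ _ (.ax (T := chain T k) (preservation R j) (.preservation R j) (Fin.append n m))
    simp only [preservation, Formula.eval, Formula.eval_conj, Formula.eval_iso, Fin.append_left,
      Fin.append_right] at this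
    have e : (fun a => Fin.append n m (Fin.castAdd _ a)) = n := funext (Fin.append_left n m)
    have e' : (fun a => Fin.append n m (Fin.natAdd _ a)) = m := funext (Fin.append_right n m)
    erw [e, e'] at this
    exact le_trans (le_inf (inf_le_left.trans (hrel R n m)) le_rfl) (this.trans inf_le_right)
  · intro R n m
    have := h _ _ (.ax (T := chain T k) (reflection R j) (.reflection R j) (Fin.append n m))
    simp only [reflection, preservation, Formula.eval, Formula.eval_conj, Formula.eval_iso,
      Fin.append_left, Fin.append_right] at this
    have e : (fun a => Fin.append n m (Fin.castAdd _ a)) = n := funext (Fin.append_left n m)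
    have e' : (fun a => Fin.append n m (Fin.natAdd _ a)) = m := funext (Fin.append_right n m)
    erw [e, e'] at this
    exact le_trans (le_inf (inf_le_left.trans (hrel R n m)) le_rfl) (this.trans inf_le_right)

theorem isModel_glue {g : Fin (k + 1) → Basic T.sig → L} {α : Fin k → T.sig.Sorts → ℕ → ℕ → L}
    (hg : ∀ i, IsModel T (g i)) (hα : ∀ j, IsIsoRel (g j.castSucc) (g j.succ) (α j)) :
    IsModel (chain T k) (Basic.glue g α) := by
  have hcopy : ∀ i, (fun a : Basic T.sig => Basic.glue g α (a.copy i)) = g i := fun i => by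
    funext a
    cases a <;> rfl
  intro a b hab
  cases hab with
  | symm X n m => exact hg X.2 _ _ (.symm X.1 n m)
  | trans X n m l => exact hg X.2 _ _ (.trans X.1 n m l)
  | congr R n m =>
    rcases R with ⟨R, i⟩ | ⟨X, j⟩
    · exact hg i _ _ (.congr R n m)
    · refine le_trans ?_ ((hα j).congr X (n (0 : Fin 2)) (n (1 : Fin 2)) _ _)
      refine le_inf (inf_le_inf_left _ ?_) (inf_le_right.trans ?_)
      · exact Finset.inf_le (Finset.mem_univ (0 : Fin 2))
      · exact Finset.inf_le (Finset.mem_univ (1 : Fin 2))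
  | strict R n =>
    rcases R with ⟨R, i⟩ | ⟨X, j⟩
    · exact hg i _ _ (.strict R n)
    · refine Finset.le_inf fun a _ => ?_
      change Fin 2 at a
      fin_cases a
      · exact (hα j).dom_le _ _ _
      · exact (hα j).cod_le _ _ _
  | ax σ hσ n =>
    cases hσ with
    | copy i σ hσ =>
      change Fin σ.n → ℕ at n
      have := hg i _ _ (.ax σ hσ n)
      rw [← hcopy i] at this
      rw [← Formula.eval_copy, ← Formula.eval_copy] at this
      exact this
    | functionality X j =>
      simp only [functionality, Formula.eval]
      refine inf_le_right.trans (le_inf inf_le_left (le_inf (inf_le_right.trans inf_le_left) ?_))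
      rw [← inf_assoc]
      exact (hα j).func _ _ _ _ _
    | injectivity X j =>
      simp only [injectivity, functionality, Formula.eval]
      refine inf_le_right.trans (le_inf inf_le_left (le_inf (inf_le_right.trans inf_le_left) ?_))
      rw [← inf_assoc]
      exact (hα j).inj _ _ _ _ _
    | totality X j =>
      simp only [totality, Formula.eval, Formula.eval_iso]
      exact inf_le_left.trans ((Finset.inf_le (Finset.mem_univ (0 : Fin 1))).trans
        ((hα j).total X _))
    | surjectivity X j =>
      simp only [surjectivity, Formula.eval, Formula.eval_iso]
      exact inf_le_left.trans ((Finset.inf_le (Finset.mem_univ (0 : Fin 1))).trans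
        ((hα j).surj X _))
    | preservation R j =>
      refine inf_le_right.trans (le_inf inf_le_left (le_trans (inf_le_inf_right _ ?_)
        ((hα j).pres R (fun a => n (Fin.castAdd _ a)) (fun a => n (Fin.natAdd _ a)))))
      exact (Formula.eval_conj _ _ _).le
    | reflection R j =>
      refine inf_le_right.trans (le_inf inf_le_left (le_trans (inf_le_inf_right _ ?_)
        ((hα j).refl R (fun a => n (Fin.castAdd _ a)) (fun a => n (Fin.natAdd _ a)))))
      exact (Formula.eval_conj _ _ _).le

theorem IsIsoRel.id {g : Basic T.sig → L} (h : IsModel T g) :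
    IsIsoRel g g (fun X n m => g (.eqv X n m)) := by
  have symm : ∀ X n m, g (.eqv X n m) ≤ g (.eqv X m n) := fun X n m => h _ _ (.symm X n m)
  have trans : ∀ X n m l {c}, c ≤ g (.eqv X n m) → c ≤ g (.eqv X m l) → c ≤ g (.eqv X n l) :=
    fun X n m l _ h1 h2 => (le_inf h1 h2).trans (h _ _ (.trans X n m l))
  refine ⟨?_, ?_, ?_, ?_, ?_, ?_, ?_, ?_, ?_⟩
  · exact fun X n m => trans X n m n le_rfl (symm _ _ _)
  · exact fun X n m => trans X m n m (symm _ _ _) le_rfl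
  · exact fun X n m n' m' => trans X n' n m' (inf_le_left.trans (inf_le_right.trans (symm _ _ _)))
      (trans X n m m' (inf_le_left.trans inf_le_left) inf_le_right)
  · exact fun X n n' m m' => trans X m n m' (inf_le_left.trans (inf_le_left.trans (symm _ _ _)))
      (trans X n n' m' inf_le_right (inf_le_left.trans inf_le_right))
  · exact fun X n n' m m' => trans X n m n' (inf_le_left.trans inf_le_left)
      (trans X m m' n' inf_le_right (inf_le_left.trans (inf_le_right.trans (symm _ _ _))))
  · exact fun X n => le_iSup_of_le n le_rfl
  · exact fun X n => le_iSup_of_le n le_rfl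
  · exact fun R n m => (le_inf inf_le_right inf_le_left).trans (h _ _ (.congr R n m))
  · refine fun R n m => (le_inf inf_le_right (inf_le_left.trans ?_)).trans (h _ _ (.congr R m n))
    exact Finset.inf_mono_fun fun a _ => symm _ _ _

theorem IsIsoRel.inv {g g' : Basic S → L} {α : S.Sorts → ℕ → ℕ → L} (h : IsIsoRel g g' α) :
    IsIsoRel g' g (fun X n m => α X m n) := by
  refine ⟨fun X n m => h.cod_le X m n, fun X n m => h.dom_le X m n, ?_,
    fun X n n' m m' => h.inj X m m' n n', fun X n n' m m' => h.func X m m' n n',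
    h.surj, h.total, fun R n m => h.refl R m n, fun R n m => h.pres R m n⟩
  intro X n m n' m'
  rw [inf_right_comm]
  exact h.congr X m n m' n'

theorem finset_inf_iSup_le {k : ℕ} {J : Type w} [Nonempty J] (f : Fin k → J → L) (s : Finset (Fin k)) :
    (s.inf fun a => ⨆ m, f a m) ≤ ⨆ c : Fin k → J, s.inf fun a => f a (c a) := by
  classical
  induction s using Finset.induction_on with
  | empty => exact le_iSup_of_le (fun _ => Classical.arbitrary J) (by simp)
  | insert a s ha ih =>
    rw [Finset.inf_insert]
    refine (inf_le_inf_left _ ih).trans ?_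
    simp only [iSup_inf_eq, inf_iSup_eq]
    refine iSup_le fun c => iSup_le fun m => le_iSup_of_le (Function.update c a m) ?_
    rw [Finset.inf_insert, Function.update_self]
    refine inf_le_inf_left _ (Finset.inf_mono_fun fun b hb => ?_)
    rw [Function.update_of_ne (by rintro rfl; exact ha hb)]

theorem IsIsoRel.comp {g g' g'' : Basic S → L} {β γ : S.Sorts → ℕ → ℕ → L}
    (hβ : IsIsoRel g g' β) (hγ : IsIsoRel g' g'' γ) :
    IsIsoRel g g'' (fun X n p => ⨆ m, β X n m ⊓ γ X m p) := by
  refine ⟨?_, ?_, ?_, ?_, ?_, ?_, ?_, ?_, ?_⟩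
  · exact fun X n p => iSup_le fun m => inf_le_left.trans (hβ.dom_le X n m)
  · exact fun X n p => iSup_le fun m => inf_le_right.trans (hγ.cod_le X m p)
  · intro X n p n' p'
    simp only [iSup_inf_eq]
    refine iSup_le fun m => le_iSup_of_le m (le_inf ?_ ?_)
    · refine le_trans (le_inf (le_inf ?_ ?_) ?_) (hβ.congr X n m n' m)
      · exact inf_le_left.trans (inf_le_left.trans inf_le_left)
      · exact inf_le_left.trans inf_le_right
      · exact inf_le_left.trans (inf_le_left.trans (inf_le_left.trans (hβ.cod_le _ _ _)))
    · refine le_trans (le_inf (le_inf ?_ ?_) ?_) (hγ.congr X m p m p')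
      · exact inf_le_left.trans (inf_le_left.trans inf_le_right)
      · exact inf_le_left.trans (inf_le_left.trans (inf_le_right.trans (hγ.dom_le _ _ _)))
      · exact inf_le_right
  · intro X n n' p p'
    simp only [iSup_inf_eq, inf_iSup_eq]
    refine iSup_le fun m' => iSup_le fun m => ?_
    refine le_trans (le_inf (le_inf ?_ ?_) (le_trans (le_inf (le_inf ?_ ?_) ?_)
      (hβ.func X n n' m m'))) (hγ.func X m m' p p')
    all_goals first
      | exact inf_le_right
      | exact inf_le_left.trans (inf_le_left.trans inf_le_left)
      | exact inf_le_left.trans (inf_le_left.trans inf_le_right)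
      | exact inf_le_left.trans (inf_le_right.trans inf_le_left)
      | exact inf_le_left.trans (inf_le_right.trans inf_le_right)
  · intro X n n' p p'
    simp only [iSup_inf_eq, inf_iSup_eq]
    refine iSup_le fun m' => iSup_le fun m => ?_
    refine le_trans (le_inf (le_inf ?_ ?_) (le_trans (le_inf (le_inf ?_ ?_) ?_)
      (hγ.inj X m m' p p'))) (hβ.inj X n n' m m')
    all_goals first
      | exact inf_le_right
      | exact inf_le_left.trans (inf_le_left.trans inf_le_left)
      | exact inf_le_left.trans (inf_le_left.trans inf_le_right)
      | exact inf_le_left.trans (inf_le_right.trans inf_le_left)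
      | exact inf_le_left.trans (inf_le_right.trans inf_le_right)
  · intro X n
    refine (hβ.total X n).trans (iSup_le fun m => ?_)
    refine (le_inf le_rfl ((hβ.cod_le X n m).trans (hγ.total X m))).trans ?_
    rw [inf_iSup_eq]
    exact iSup_le fun p => le_iSup_of_le p (le_iSup_of_le m le_rfl)
  · intro X p
    refine (hγ.surj X p).trans (iSup_le fun m => ?_)
    refine (le_inf ((hγ.dom_le X m p).trans (hβ.surj X m)) le_rfl).trans ?_
    rw [iSup_inf_eq]
    exact iSup_le fun n => le_iSup_of_le n (le_iSup_of_le m le_rfl)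
  · intro R n p
    refine (inf_le_inf_right _ (finset_inf_iSup_le _ _)).trans ?_
    rw [iSup_inf_eq]
    refine iSup_le fun c => le_trans (le_inf ?_ ?_) (hγ.pres R c p)
    · exact inf_le_left.trans (Finset.inf_mono_fun fun a _ => inf_le_right)
    · exact le_trans (inf_le_inf_right _ (Finset.inf_mono_fun fun a _ => inf_le_left))
        (hβ.pres R n c)
  · intro R n p
    refine (inf_le_inf_right _ (finset_inf_iSup_le _ _)).trans ?_
    rw [iSup_inf_eq]
    refine iSup_le fun c => le_trans (le_inf ?_ ?_) (hβ.refl R n c)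
    · exact inf_le_left.trans (Finset.inf_mono_fun fun a _ => inf_le_left)
    · exact le_trans (inf_le_inf_right _ (Finset.inf_mono_fun fun a _ => inf_le_right))
        (hγ.refl R c p)

end Chain

/-! ### Localic groupoids -/

/-- The frame homomorphism `f^* : O Y → O X` of a locale morphism `f : X → Y`. -/
def inverseImage {X Y : Locale.{u}} (f : X ⟶ Y) : FrameHom Y X := Frm.Hom.hom f.unop

/-- The locale morphism with a given inverse image. -/
def localeMap {A B : Type u} [Order.Frame A] [Order.Frame B] (f : FrameHom A B) :
    Locale.of B ⟶ Locale.of A := (Frm.ofHom f).op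

/-- A locale morphism is open if its inverse image has a left adjoint that satisfies Frobenius
reciprocity. -/
def IsOpenLocaleMap {X Y : Locale.{u}} (f : X ⟶ Y) : Prop :=
  ∃ f_shriek : X → Y, GaloisConnection f_shriek (inverseImage f) ∧
    ∀ (u : Y) (v : X), f_shriek (inverseImage f u ⊓ v) = u ⊓ f_shriek v

/-- The diagrams in the category of locales that underlie localic groupoids; `G₂` is the locale of
composable pairs, with projections `π₁`, `π₂`. -/
structure GroupoidDiagram where
  (G₀ G₁ G₂ : Locale.{u})
  (s t : G₁ ⟶ G₀)
  (e : G₀ ⟶ G₁)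
  (i : G₁ ⟶ G₁)
  (π₁ π₂ m : G₂ ⟶ G₁)

/-- The diagram is a localic groupoid. Since `G₂` is the pullback `G₁ ×_{G₀} G₁`, a morphism
`W ⟶ G₂` is a pair of composable `W`-points of `G₁`, and the laws that involve induced maps into
`G₂` are stated for the (unique) morphism with the required projections. -/
structure GroupoidDiagram.IsLocalicGroupoid (G : GroupoidDiagram.{u}) : Prop where
  isPullback : IsPullback G.π₁ G.π₂ G.t G.s
  e_s : G.e ≫ G.s = 𝟙 G.G₀
  e_t : G.e ≫ G.t = 𝟙 G.G₀
  m_s : G.m ≫ G.s = G.π₁ ≫ G.s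
  m_t : G.m ≫ G.t = G.π₂ ≫ G.t
  /-- For `p = (f, g)`, `q = (g, h)`, `a = (m(f, g), h)` and `b = (f, m(g, h))`. -/
  assoc : ∀ {W : Locale.{u}} (p q a b : W ⟶ G.G₂), p ≫ G.π₂ = q ≫ G.π₁ →
    a ≫ G.π₁ = p ≫ G.m → a ≫ G.π₂ = q ≫ G.π₂ →
    b ≫ G.π₁ = p ≫ G.π₁ → b ≫ G.π₂ = q ≫ G.m → a ≫ G.m = b ≫ G.m
  e_comp : ∀ p : G.G₁ ⟶ G.G₂, p ≫ G.π₁ = G.s ≫ G.e → p ≫ G.π₂ = 𝟙 G.G₁ → p ≫ G.m = 𝟙 G.G₁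
  comp_e : ∀ p : G.G₁ ⟶ G.G₂, p ≫ G.π₁ = 𝟙 G.G₁ → p ≫ G.π₂ = G.t ≫ G.e → p ≫ G.m = 𝟙 G.G₁
  i_s : G.i ≫ G.s = G.t
  i_t : G.i ≫ G.t = G.s
  comp_i : ∀ p : G.G₁ ⟶ G.G₂, p ≫ G.π₁ = 𝟙 G.G₁ → p ≫ G.π₂ = G.i → p ≫ G.m = G.s ≫ G.e
  i_comp : ∀ p : G.G₁ ⟶ G.G₂, p ≫ G.π₁ = G.i → p ≫ G.π₂ = 𝟙 G.G₁ → p ≫ G.m = G.t ≫ G.e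
  i_i : G.i ≫ G.i = 𝟙 G.G₁

/-- An open localic groupoid: source and target are open. -/
structure GroupoidDiagram.IsOpenLocalicGroupoid (G : GroupoidDiagram.{u}) : Prop extends
    G.IsLocalicGroupoid where
  s_open : IsOpenLocaleMap G.s
  t_open : IsOpenLocaleMap G.t

/-! ### The groupoid `G^T` -/

section Representing

variable (T : Theory.{u})

/-- The frame map that sends a basic proposition to its `i`-th copy. -/
noncomputable def copyHom (k : ℕ) (i : Fin (k + 1)) : FrameHom (Opens T) (Opens (chain T k)) :=
  Opens.lift (fun a => Opens.of (chain T k) (a.copy i)) ((Opens.isModel_of _).copy i)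

/-- `s^* : [n ∈ R] ↦ [n ∈ R_1]`. -/
noncomputable abbrev sourceHom : FrameHom (Opens T) (Opens (isoTheory T)) := copyHom T 1 0

/-- `t^* : [n ∈ R] ↦ [n ∈ R_2]`. -/
noncomputable abbrev targetHom : FrameHom (Opens T) (Opens (isoTheory T)) := copyHom T 1 1

/-- `e^*` sends both copies of a basic proposition to that proposition, and `[α^X(n) = m]` to
`[n ∼^X m]`. -/
noncomputable def identityHom : FrameHom (Opens (isoTheory T)) (Opens T) :=
  Opens.lift (T := isoTheory T)
    (Basic.glue (fun _ => Opens.of T) (fun _ X n m => Opens.of T (.eqv X n m)))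
    (isModel_glue (fun _ => Opens.isModel_of T) fun _ => .id (Opens.isModel_of T))

/-- `i^*` swaps the two copies and sends `[α^X(n) = m]` to `[α^X(m) = n]`. -/
noncomputable def inversionHom : FrameHom (Opens (isoTheory T)) (Opens (isoTheory T)) :=
  Opens.lift (T := isoTheory T)
    (Basic.glue (fun i a => Opens.of (isoTheory T) (a.copy i.rev))
      (fun _ X n m => Opens.of (isoTheory T) (.iso 0 X m n)))
    (isModel_glue (fun i => (Opens.isModel_of (isoTheory T)).copy i.rev) fun j => by
      have h := ((Opens.isModel_of (isoTheory T)).isIsoRel 0).inv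
      fin_cases j
      exact h)

/-- `π₁^*` and `π₂^*` (for `j = 0` and `j = 1`): the two copies of `T` go to the copies with number
`j` and `j + 1`, and `α` goes to the `j`-th of the two isomorphisms. -/
noncomputable def projHom (j : Fin 2) : FrameHom (Opens (isoTheory T)) (Opens (isoPairTheory T)) :=
  Opens.lift (T := isoTheory T)
    (Basic.glue (fun i a => Opens.of (isoPairTheory T) (a.copy (![j.castSucc, j.succ] i)))
      (fun _ X n m => Opens.of (isoPairTheory T) (.iso j X n m)))
    (isModel_glue (fun i => (Opens.isModel_of (isoPairTheory T)).copy _) fun l => by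
      have h := (Opens.isModel_of (isoPairTheory T)).isIsoRel j
      fin_cases l
      exact h)

/-- `m^*` sends the two copies of `T` to the first and the third copy, and `[α^X(n) = p]` to
`⋁_m [β^X(n) = m] ∧ [γ^X(m) = p]`. -/
noncomputable def compositionHom :
    FrameHom (Opens (isoTheory T)) (Opens (isoPairTheory T)) :=
  Opens.lift (T := isoTheory T)
    (Basic.glue (fun i a => Opens.of (isoPairTheory T) (a.copy (![0, 2] i)))
      (fun _ X n p => ⨆ m : ℕ, Opens.of (isoPairTheory T) (.iso 0 X n m) ⊓
        Opens.of (isoPairTheory T) (.iso 1 X m p)))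
    (isModel_glue (fun i => (Opens.isModel_of (isoPairTheory T)).copy _) fun l => by
      have h := IsIsoRel.comp
        ((Opens.isModel_of (isoPairTheory T)).isIsoRel 0)
        ((Opens.isModel_of (isoPairTheory T)).isIsoRel 1)
      fin_cases l
      exact h)

/-- The localic groupoid `G^T`. -/
noncomputable def representingGroupoid : GroupoidDiagram.{u} where
  G₀ := Locale.of (Opens T)
  G₁ := Locale.of (Opens (isoTheory T))
  G₂ := Locale.of (Opens (isoPairTheory T))
  s := localeMap (sourceHom T)
  t := localeMap (targetHom T)
  e := localeMap (identityHom T)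
  i := localeMap (inversionHom T)
  π₁ := localeMap (projHom T 0)
  π₂ := localeMap (projHom T 1)
  m := localeMap (compositionHom T)

end Representing

/-! ### The formula for the left adjoint of the source map -/

section LeftAdjoint

variable {S : Signature.{u}}

/-- The variables `(n, X)` that occur in a basic proposition. -/
def Basic.vars : Basic S → Set (S.Sorts × ℕ)
  | eqv X n m => {(X, n), (X, m)}
  | rel R n => Set.range fun a => (S.dom R a, n a)

/-- Replace each natural number `n` standing for a variable of sort `X` by `y (X, n)`. -/
def Basic.subst (y : S.Sorts × ℕ → ℕ) : Basic S → Basic S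
  | eqv X n m => eqv X (y (X, n)) (y (X, m))
  | rel R n => rel R fun a => y (S.dom R a, n a)

/-- The set `V` of variables of the second copy that occur in `⋀_{b ∈ J} b_2` or in
`⋀_{(X, c, d) ∈ K} [α^X(c) = d]`. -/
def codomainVars (J : Finset (Basic S)) (K : Finset (S.Sorts × ℕ × ℕ)) : Set (S.Sorts × ℕ) :=
  {p | (∃ b ∈ J, p ∈ b.vars) ∨ ∃ q ∈ K, p = (q.1, q.2.2)}

variable (T : Theory.{u})

/-- The basic open `⋀_{a ∈ I} a_1 ∧ ⋀_{b ∈ J} b_2 ∧ ⋀_{(X, c, d) ∈ K} [α^X(c) = d]` of `G₁`. -/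
noncomputable def basicOpen (I J : Finset (Basic T.sig)) (K : Finset (T.sig.Sorts × ℕ × ℕ)) :
    Opens (isoTheory T) :=
  (I.inf fun a => Opens.of (isoTheory T) (a.copy 0)) ⊓
    (J.inf fun b => Opens.of (isoTheory T) (b.copy 1)) ⊓
    K.inf fun q => Opens.of (isoTheory T) (.iso 0 q.1 q.2.1 q.2.2)

/-- The open `⋀_{a ∈ I} a ∧ ⋁_{y ∈ ℕ^V} (⋀_{b ∈ J} b(y) ∧ ⋀_{(X, c, d) ∈ K} [c ∼^X y(X, d)])` of
`G₀`. The tuple `y` is extended by `0` outside `V`, where its values are not used. -/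
noncomputable def basicImage (I J : Finset (Basic T.sig)) (K : Finset (T.sig.Sorts × ℕ × ℕ)) :
    Opens T :=
  (I.inf fun a => Opens.of T a) ⊓
    ⨆ y : codomainVars J K → ℕ,
      (J.inf fun b => Opens.of T (b.subst (Function.extend Subtype.val y 0))) ⊓
      K.inf fun q => Opens.of T
        (.eqv q.1 q.2.1 (Function.extend Subtype.val y 0 (q.1, q.2.2)))

end LeftAdjoint

end GeomRep

namespace GeomRep

/-! ### Presented frames are generated by their generators -/

section Generators

/-! A model of `P[T]` is a `T`-model whose sorts are partially enumerated by `ℕ`, and a point of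
`G₁` is an isomorphism between two of these. The source map has many sections: if `y` maps `ℕ` onto
`ℕ` in each sort, a model `M` can be renumbered along `y`, and `[n ∼ y(m)]` is the graph of an
isomorphism from `M` to the renumbered model. Surjectivity ensures that existential quantifiers,
which are joins over all of `ℕ`, keep their value and that this graph is total.

The left adjoint `s_!` is the join of the inverse images `reindexHom` along all these sections. Each
of them is a retraction of `s^*`. This yields the counit, and together with distributivity it yields
Frobenius reciprocity. The unit `z ≤ s^* s_! z` is the substantial point
(`le_sourceHom_sourceImage`). Every open is a join of finite meets of basic propositions, and such a
meet mentions only finitely many elements of the codomain. These are defined there, so they have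
preimages under `α`, and finite distributivity covers the meet by pieces on which chosen numbers
`y(p)` are such preimages. Since `α` is an isomorphism, what holds of the elements `p` in the
codomain holds of the `y(p)` in the domain, so the piece lies in the inverse image along the section
of any sortwise surjective function that agrees with `y` on those elements. Such a function exists
because only finitely many values are prescribed. For the same reason, on a basic open the join over
sortwise surjective functions equals the join over `ℕ^V`, which is the explicit formula.

The groupoid laws are equations of frame homomorphisms, hence can be checked on generators. On
copies of basic propositions they record sources and targets; on `[α(n) = m]` they are the calculus
of bijective relations. The pullback property holds because a composable pair of isomorphisms is the
same as a model of the theory of pairs. Openness of `t` follows from `t = s ∘ i` with `i` an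
involution. -/

theorem FreeFrame.inf_of {A : Type u} (F : Finset A) :
    F.inf FreeFrame.of = LowerSet.Iic (OrderDual.toDual F) := by
  classical
  induction F using Finset.induction_on with
  | empty => exact (top_le_iff.1 fun G _ => Finset.empty_subset (OrderDual.ofDual G)).symm
  | insert a F ha ih =>
    rw [Finset.inf_insert, ih]
    ext G
    change ({a} ⊆ OrderDual.ofDual G ∧ F ⊆ OrderDual.ofDual G) ↔ insert a F ⊆ OrderDual.ofDual G
    rw [Finset.singleton_subset_iff, Finset.insert_subset_iff]

theorem FreeFrame.eq_iSup_inf_of {A : Type u} (U : FreeFrame A) :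
    U = ⨆ F : Finset A, ⨆ _ : OrderDual.toDual F ∈ U, F.inf FreeFrame.of := by
  apply le_antisymm
  · intro G hG
    refine LowerSet.mem_iSup₂_iff.2 ⟨OrderDual.ofDual G, hG, ?_⟩
    rw [FreeFrame.inf_of]
    exact le_refl G
  · refine iSup₂_le fun F hF => ?_
    rw [FreeFrame.inf_of]
    exact LowerSet.Iic_le.2 hF

variable {T : Theory.{u}} {L : Type v} [Order.Frame L]

/-- Every open is a join of finite meets of basic propositions. -/
theorem Opens.eq_iSup_inf_of (z : Opens T) :
    z = ⨆ F : Finset (Basic T.sig), ⨆ _ : OrderDual.toDual F ∈ z.val, F.inf (Opens.of T) := by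
  conv_lhs => rw [← Presented.mk_val z, FreeFrame.eq_iSup_inf_of z.val]
  simp only [map_iSup, map_finset_inf]
  rfl

/-- Frame homomorphisms preserve the finite meets and arbitrary joins by which the generators
produce every open. This reduces the groupoid laws to generators. -/
theorem Opens.hom_ext {f f' : FrameHom (Opens T) L}
    (h : ∀ a, f (Opens.of T a) = f' (Opens.of T a)) : f = f' := by
  refine DFunLike.ext _ _ fun z => ?_
  rw [Opens.eq_iSup_inf_of z]
  simp only [map_iSup, map_finset_inf]
  refine iSup_congr fun F => iSup_congr fun _ => Finset.inf_congr rfl fun a _ => h a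

theorem Basic.chain_cases {S : Signature.{u}} {k : ℕ} {p : Basic (chainSig S k) → Prop}
    (copy : ∀ i (a : Basic S), p (a.copy i)) (iso : ∀ j X n m, p (.iso j X n m)) (a) : p a := by
  rcases a with ⟨⟨X, i⟩, n, m⟩ | ⟨⟨R, i⟩ | ⟨X, j⟩, n⟩
  · exact copy i (.eqv X n m)
  · exact copy i (.rel R n)
  -- The arity of `α` is `2` only by unfolding, so the argument tuple is first brought into the form
  -- used by `Basic.iso`.
  · have : n = (![n (0 : Fin 2), n (1 : Fin 2)] : Fin 2 → ℕ) := by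
      funext i
      change Fin 2 at i
      fin_cases i <;> rfl
    rw [this]
    exact iso j X _ _

theorem Basic.glue_copy {S : Signature.{u}} {k : ℕ} {L : Type v} (g : Fin (k + 1) → Basic S → L)
    (α : Fin k → S.Sorts → ℕ → ℕ → L) (i : Fin (k + 1)) (a : Basic S) :
    Basic.glue g α (a.copy i) = g i a := by
  cases a <;> rfl

theorem Basic.glue_iso {S : Signature.{u}} {k : ℕ} {L : Type v} (g : Fin (k + 1) → Basic S → L)
    (α : Fin k → S.Sorts → ℕ → ℕ → L) (j : Fin k) (X : S.Sorts) (n m : ℕ) :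
    Basic.glue g α (.iso j X n m) = α j X n m := rfl

theorem Opens.chain_hom_ext {k : ℕ} {f f' : FrameHom (Opens (chain T k)) L}
    (copy : ∀ i (a : Basic T.sig),
      f (Opens.of (chain T k) (a.copy i)) = f' (Opens.of (chain T k) (a.copy i)))
    (iso : ∀ j X n m,
      f (Opens.of (chain T k) (.iso j X n m)) = f' (Opens.of (chain T k) (.iso j X n m))) :
    f = f' :=
  Opens.hom_ext (Basic.chain_cases copy iso)

end Generators

/-! ### The structure maps on generators -/

section StructureMaps

variable (T : Theory.{u})

theorem copyHom_of (k : ℕ) (i : Fin (k + 1)) (a : Basic T.sig) :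
    copyHom T k i (Opens.of T a) = Opens.of (chain T k) (a.copy i) := Opens.lift_of _ _ _

theorem identityHom_copy (i : Fin 2) (a : Basic T.sig) :
    identityHom T (Opens.of (isoTheory T) (a.copy i)) = Opens.of T a :=
  (Opens.lift_of _ _ _).trans (Basic.glue_copy _ _ _ _)

theorem identityHom_iso (j : Fin 1) (X : T.sig.Sorts) (n m : ℕ) :
    identityHom T (Opens.of (isoTheory T) (.iso j X n m)) = Opens.of T (.eqv X n m) :=
  Opens.lift_of _ _ _

theorem inversionHom_copy (i : Fin 2) (a : Basic T.sig) :
    inversionHom T (Opens.of (isoTheory T) (a.copy i)) = Opens.of (isoTheory T) (a.copy i.rev) :=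
  (Opens.lift_of _ _ _).trans (Basic.glue_copy _ _ _ _)

theorem inversionHom_iso (j : Fin 1) (X : T.sig.Sorts) (n m : ℕ) :
    inversionHom T (Opens.of (isoTheory T) (.iso j X n m)) =
      Opens.of (isoTheory T) (.iso 0 X m n) :=
  Opens.lift_of _ _ _

theorem projHom_copy (j i : Fin 2) (a : Basic T.sig) :
    projHom T j (Opens.of (isoTheory T) (a.copy i)) =
      Opens.of (isoPairTheory T) (a.copy (![j.castSucc, j.succ] i)) :=
  (Opens.lift_of _ _ _).trans (Basic.glue_copy _ _ _ _)

theorem projHom_iso (j : Fin 2) (l : Fin 1) (X : T.sig.Sorts) (n m : ℕ) :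
    projHom T j (Opens.of (isoTheory T) (.iso l X n m)) =
      Opens.of (isoPairTheory T) (.iso j X n m) :=
  Opens.lift_of _ _ _

theorem compositionHom_copy (i : Fin 2) (a : Basic T.sig) :
    compositionHom T (Opens.of (isoTheory T) (a.copy i)) =
      Opens.of (isoPairTheory T) (a.copy (![0, 2] i)) :=
  (Opens.lift_of _ _ _).trans (Basic.glue_copy _ _ _ _)

theorem compositionHom_iso (l : Fin 1) (X : T.sig.Sorts) (n p : ℕ) :
    compositionHom T (Opens.of (isoTheory T) (.iso l X n p)) =
      ⨆ m : ℕ, Opens.of (isoPairTheory T) (.iso 0 X n m) ⊓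
        Opens.of (isoPairTheory T) (.iso 1 X m p) :=
  Opens.lift_of _ _ _

end StructureMaps

/-! ### Models reindexed along enumerations -/

section Reindex

/-- In every sort, `y` enumerates all of `ℕ`. -/
def SortwiseSurjective {K : Type u} (y : K × ℕ → ℕ) : Prop := ∀ X m, ∃ n, y (X, n) = m

/-- Any function agrees on a given finite set with a sortwise surjective one. -/
theorem exists_sortwiseSurjective_eqOn {K : Type u} {V : Set (K × ℕ)} (hV : V.Finite)
    (y : K × ℕ → ℕ) : ∃ y', SortwiseSurjective y' ∧ Set.EqOn y' y V := by
  obtain ⟨N, hN⟩ := (hV.image Prod.snd).bddAbove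
  -- `N` bounds the numbers occurring in `V`. Up to `N` the function `y` is kept; the numbers from
  -- `N + 1` on enumerate all of `ℕ` again.
  refine ⟨fun p => if p.2 ≤ N then y p else p.2 - (N + 1), fun X m => ⟨m + (N + 1), ?_⟩,
    fun p hp => if_pos (hN ⟨p, hp, rfl⟩)⟩
  have : ¬ m + (N + 1) ≤ N := by omega
  simp [this]

variable {L : Type v} [Order.Frame L]

/-- Surjectivity enters only at an existential quantifier, where the join over the values `y(X, m)`
must be the join over all of `ℕ`. Well-typedness is needed because `Basic.subst` reads sorts off the
symbols, whereas the right-hand side reads them off the context. -/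
theorem Formula.eval_subst {S : Signature.{u}} (g : Basic S → L) {y : S.Sorts × ℕ → ℕ}
    (hy : SortwiseSurjective y) : {n : ℕ} → (φ : Formula S n) → (Γ : Fin n → S.Sorts) →
    φ.WellTyped Γ → (ρ : Fin n → ℕ) →
    φ.eval (fun a => g (a.subst y)) ρ = φ.eval g fun i => y (Γ i, ρ i)
  | _, rel R x, Γ, h, ρ => by
    change ∀ i, Γ (x i) = S.dom R i at h
    simp only [eval, Basic.subst, h]
  | _, eq X x x', Γ, h, ρ => by
    obtain ⟨h, h'⟩ := h
    simp only [eval, Basic.subst, h, h']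
  | _, top, _, _, _ => rfl
  | _, and φ ψ, Γ, h, ρ => by
    simp only [eval, eval_subst g hy φ Γ h.1, eval_subst g hy ψ Γ h.2]
  | _, disj φ, Γ, h, ρ => by simp only [eval, fun i => eval_subst g hy (φ i) Γ (h i)]
  | _, ex X φ, Γ, h, ρ => by
    have e : ∀ m, (fun i => y ((Fin.cons X Γ : Fin (_ + 1) → S.Sorts) i,
        (Fin.cons m ρ : Fin (_ + 1) → ℕ) i)) =
        (Fin.cons (y (X, m)) fun i => y (Γ i, ρ i) : Fin (_ + 1) → ℕ) := fun m => by
      funext i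
      refine Fin.cases rfl (fun i => rfl) i
    simp only [eval, eval_subst g hy φ _ h, e]
    exact Function.Surjective.iSup_comp (f := fun m => y (X, m)) (hy X)
      fun m => φ.eval g (Fin.cons m fun i => y (Γ i, ρ i) : Fin (_ + 1) → ℕ)

variable {T : Theory.{u}} {g : Basic T.sig → L}

/-- Each axiom instance at a tuple `n` becomes the instance of the same axiom at the renumbered
tuple. -/
theorem IsModel.subst (h : IsModel T g) {y : T.sig.Sorts × ℕ → ℕ} (hy : SortwiseSurjective y) :
    IsModel T fun a => g (a.subst y) := by
  intro a b hab
  cases hab with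
  | symm X n m => exact h _ _ (.symm X _ _)
  | trans X n m l => exact h _ _ (.trans X _ _ _)
  | congr R n m => exact h _ _ (.congr R _ _)
  | strict R n => exact h _ _ (.strict R _)
  | ax σ hσ n =>
    rw [Formula.eval_subst g hy _ _ σ.lhs_wellTyped, Formula.eval_subst g hy _ _ σ.rhs_wellTyped]
    exact h _ _ (.ax σ hσ _)

/-- A model is isomorphic to its reindexing along an enumeration. -/
theorem IsIsoRel.subst (h : IsModel T g) {y : T.sig.Sorts × ℕ → ℕ} (hy : SortwiseSurjective y) :
    IsIsoRel g (fun a => g (a.subst y)) (fun X n m => g (.eqv X n (y (X, m)))) := by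
  have hid := IsIsoRel.id h
  refine ⟨fun X n m => hid.dom_le X _ _, fun X n m => hid.cod_le X _ _,
    fun X n m n' m' => hid.congr X _ _ _ _, fun X n n' m m' => hid.func X _ _ _ _,
    fun X n n' m m' => hid.inj X _ _ _ _, fun X n => ?_, fun X m => hid.surj X _,
    fun R n m => hid.pres R _ _, fun R n m => hid.refl R _ _⟩
  -- Totality is the only condition on the isomorphism that uses surjectivity of `y`; the others are
  -- instances of those for the identity.
  obtain ⟨m, hm⟩ := hy X n
  exact le_iSup_of_le m (by rw [hm])

end Reindex

/-! ### The left adjoint of the source map -/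

section SourceAdjoint

variable (T : Theory.{u})

/-- The section of the source map that sends a model to the isomorphism with its reindexing along
the enumeration `y`. -/
noncomputable def reindexHom (y : T.sig.Sorts × ℕ → ℕ) (hy : SortwiseSurjective y) :
    FrameHom (Opens (isoTheory T)) (Opens T) :=
  Opens.lift (T := isoTheory T)
    (Basic.glue ![Opens.of T, fun a => Opens.of T (a.subst y)]
      (fun _ X n m => Opens.of T (.eqv X n (y (X, m)))))
    (isModel_glue
      (fun i => by
        fin_cases i
        · exact Opens.isModel_of T
        · exact (Opens.isModel_of T).subst hy)
      (fun j => by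
        fin_cases j
        exact IsIsoRel.subst (Opens.isModel_of T) hy))

variable {T} in
theorem reindexHom_copy_zero {y : T.sig.Sorts × ℕ → ℕ} (hy : SortwiseSurjective y)
    (a : Basic T.sig) :
    reindexHom T y hy (Opens.of (isoTheory T) (a.copy 0)) = Opens.of T a :=
  (Opens.lift_of _ _ _).trans (Basic.glue_copy _ _ _ _)

variable {T} in
theorem reindexHom_copy_one {y : T.sig.Sorts × ℕ → ℕ} (hy : SortwiseSurjective y)
    (a : Basic T.sig) :
    reindexHom T y hy (Opens.of (isoTheory T) (a.copy 1)) = Opens.of T (a.subst y) :=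
  (Opens.lift_of _ _ _).trans (Basic.glue_copy _ _ _ _)

variable {T} in
theorem reindexHom_iso {y : T.sig.Sorts × ℕ → ℕ} (hy : SortwiseSurjective y)
    (j : Fin 1) (X : T.sig.Sorts) (n m : ℕ) :
    reindexHom T y hy (Opens.of (isoTheory T) (.iso j X n m)) =
      Opens.of T (.eqv X n (y (X, m))) :=
  Opens.lift_of _ _ _

variable {T} in
theorem reindexHom_sourceHom {y : T.sig.Sorts × ℕ → ℕ} (hy : SortwiseSurjective y)
    (x : Opens T) : reindexHom T y hy (sourceHom T x) = x := by
  have : (reindexHom T y hy).comp (sourceHom T) = FrameHom.id _ :=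
    Opens.hom_ext fun a => by
      rw [FrameHom.comp_apply, copyHom_of, reindexHom_copy_zero, FrameHom.id_apply]
  exact DFunLike.congr_fun this x

/-- The direct image along the source map: the join of the inverse images along its sections
`reindexHom`. -/
noncomputable def sourceImage (z : Opens (isoTheory T)) : Opens T :=
  ⨆ y : {y : T.sig.Sorts × ℕ → ℕ // SortwiseSurjective y}, reindexHom T y.1 y.2 z

theorem sourceImage_mono : Monotone (sourceImage T) := fun _ _ h =>
  iSup_mono fun y => OrderHomClass.mono (reindexHom T y.1 y.2) h

/-- Each `reindexHom` preserves meets and fixes `x` after `sourceHom`, so this is distributivity of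
a meet over the join of all sections. -/
theorem sourceImage_frobenius (x : Opens T) (z : Opens (isoTheory T)) :
    sourceImage T (sourceHom T x ⊓ z) = x ⊓ sourceImage T z := by
  simp only [sourceImage, map_inf, reindexHom_sourceHom, inf_iSup_eq]

/-! ### The direct image of basic opens -/

theorem Basic.finite_vars {S : Signature.{u}} (a : Basic S) : a.vars.Finite := by
  cases a with
  | eqv X n m => exact (Set.finite_singleton _).insert _
  | rel R n => exact Set.finite_range _

theorem Basic.subst_congr {S : Signature.{u}} {a : Basic S} {y y' : S.Sorts × ℕ → ℕ}
    (h : Set.EqOn y y' a.vars) : a.subst y = a.subst y' := by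
  cases a with
  | eqv X n m =>
    have h1 : y (X, n) = y' (X, n) := h (Or.inl rfl)
    have h2 : y (X, m) = y' (X, m) := h (Or.inr rfl)
    simp only [Basic.subst, h1, h2]
  | rel R n =>
    have h1 : ∀ i, y (S.dom R i, n i) = y' (S.dom R i, n i) := fun i => h ⟨i, rfl⟩
    simp only [Basic.subst, h1]

theorem codomainVars_finite {S : Signature.{u}} (J : Finset (Basic S))
    (K : Finset (S.Sorts × ℕ × ℕ)) : (codomainVars J K).Finite := by
  have : codomainVars J K ⊆
      (⋃ b ∈ (J : Set (Basic S)), b.vars) ∪ (fun q : S.Sorts × ℕ × ℕ => (q.1, q.2.2)) '' (K : Set (S.Sorts × ℕ × ℕ)) := by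
    rintro p (⟨b, hb, hp⟩ | ⟨q, hq, rfl⟩)
    · exact Or.inl (Set.mem_biUnion hb hp)
    · exact Or.inr ⟨q, hq, rfl⟩
  exact ((J.finite_toSet.biUnion fun b _ => b.finite_vars).union
    (K.finite_toSet.image _)).subset this

/-- Both sides are joins of the same expression in `y`, on the left over sortwise surjective
functions and on the right over functions on `V`. The expression depends only on the restriction of
`y` to the finite set `V`, and every function on `V` is the restriction of a sortwise surjective
one. -/
theorem sourceImage_basicOpen (I J : Finset (Basic T.sig)) (K : Finset (T.sig.Sorts × ℕ × ℕ)) :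
    sourceImage T (basicOpen T I J K) = basicImage T I J K := by
  let E (y : T.sig.Sorts × ℕ → ℕ) : Opens T :=
    (J.inf fun b => Opens.of T (b.subst y)) ⊓
      K.inf fun q => Opens.of T (.eqv q.1 q.2.1 (y (q.1, q.2.2)))
  have hE : ∀ y y', Set.EqOn y y' (codomainVars J K) → E y = E y' := fun y y' h => by
    refine congrArg₂ (· ⊓ ·) (Finset.inf_congr rfl fun b hb => ?_) (Finset.inf_congr rfl fun q hq => ?_)
    · rw [Basic.subst_congr fun p hp => h (Or.inl ⟨b, hb, hp⟩)]
    · rw [h (Or.inr ⟨q, hq, rfl⟩)]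
  have hleft : sourceImage T (basicOpen T I J K) = (I.inf fun a => Opens.of T a) ⊓
      ⨆ y : {y : T.sig.Sorts × ℕ → ℕ // SortwiseSurjective y}, E y.1 := by
    simp only [sourceImage, basicOpen, map_inf, map_finset_inf, Function.comp_def,
      reindexHom_copy_zero, reindexHom_copy_one, reindexHom_iso, inf_assoc, inf_iSup_eq, E]
  rw [hleft]
  change _ = _ ⊓ ⨆ y : codomainVars J K → ℕ, E (Function.extend Subtype.val y 0)
  congr 1
  apply le_antisymm
  · refine iSup_le fun y => le_iSup_of_le (fun p => y.1 p.1) (hE _ _ fun p hp => ?_).le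
    exact (Subtype.val_injective.extend_apply (fun p : codomainVars J K => y.1 p.1) 0
      ⟨p, hp⟩).symm
  · refine iSup_le fun y => ?_
    -- The extension by `0` need not be sortwise surjective, so it is altered outside `V`.
    obtain ⟨y', hy', h⟩ := exists_sortwiseSurjective_eqOn (codomainVars_finite J K)
      (Function.extend Subtype.val y 0)
    exact le_iSup_of_le ⟨y', hy'⟩ (hE _ _ h.symm).le

/-! ### The unit of the adjunction -/

theorem finset_inf_iSup_le_iSup_inf {ι : Type u} {κ : Type v} {L : Type w} [Order.Frame L]
    [Nonempty κ] (f : ι → κ → L) (s : Finset ι) :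
    (s.inf fun a => ⨆ m, f a m) ≤ ⨆ c : ι → κ, s.inf fun a => f a (c a) := by
  classical
  induction s using Finset.induction_on with
  | empty => exact le_iSup_of_le (fun _ => Classical.arbitrary κ) (by simp)
  | insert a s ha ih =>
    rw [Finset.inf_insert]
    refine (inf_le_inf_left _ ih).trans ?_
    simp only [iSup_inf_eq, inf_iSup_eq]
    refine iSup_le fun c => iSup_le fun m => le_iSup_of_le (Function.update c a m) ?_
    rw [Finset.inf_insert, Function.update_self]
    refine inf_le_inf_left _ (Finset.inf_mono_fun fun b hb => ?_)
    rw [Function.update_of_ne (by rintro rfl; exact ha hb)]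

/-- A basic proposition of the iso theory only mentions finitely many elements of the codomain;
where these are all defined and have the preimages `y`, it implies its inverse image along the
section given by `y`. -/
theorem exists_finite_codomain (a : Basic (isoTheory T).sig) :
    ∃ V : Finset (T.sig.Sorts × ℕ),
      (∀ p ∈ V, Opens.of (isoTheory T) a ≤
        Opens.of (isoTheory T) ((Basic.eqv p.1 p.2 p.2).copy 1)) ∧
      ∀ (y y' : T.sig.Sorts × ℕ → ℕ) (hy' : SortwiseSurjective y'), Set.EqOn y' y V →
        Opens.of (isoTheory T) a ⊓
            V.inf (fun p => Opens.of (isoTheory T) (.iso 0 p.1 (y p) p.2)) ≤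
          sourceHom T (reindexHom T y' hy' (Opens.of (isoTheory T) a)) := by
  have hM := (Opens.isModel_of (isoTheory T)).copy (1 : Fin 2)
  have hα := (Opens.isModel_of (isoTheory T)).isIsoRel 0
  have hid := IsIsoRel.id hM
  revert a
  refine Basic.chain_cases (fun i a => ?_) (fun j X n m => ?_)
  · fin_cases i
    -- A proposition about the domain mentions no element of the codomain and is unchanged by
    -- passing to the section and back.
    · refine ⟨∅, by simp, fun y y' hy' _ => inf_le_left.trans ?_⟩
      change _ ≤ sourceHom T (reindexHom T y' hy' (Opens.of (isoTheory T) (a.copy 0)))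
      rw [reindexHom_copy_zero, copyHom_of]
      exact le_rfl
    -- For a proposition about the codomain all its variables are taken. They are defined by
    -- strictness (for `∼`, by symmetry and transitivity), and the proposition is pulled back along
    -- `α` by injectivity or by reflection of relations.
    · refine ⟨a.finite_vars.toFinset, fun p hp => ?_, fun y y' hy' h => ?_⟩
      · rw [Set.Finite.mem_toFinset] at hp
        cases a with
        | eqv X n m =>
          rcases hp with rfl | rfl
          · exact hid.dom_le X n m
          · exact hid.cod_le X n m
        | rel R n =>
          obtain ⟨i, rfl⟩ := hp
          exact (hM _ _ (.strict R n)).trans (Finset.inf_le (Finset.mem_univ i))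
      · change Opens.of (isoTheory T) (a.copy 1) ⊓ _ ≤
          sourceHom T (reindexHom T y' hy' (Opens.of (isoTheory T) (a.copy 1)))
        rw [reindexHom_copy_one, copyHom_of]
        rw [Set.Finite.coe_toFinset] at h
        have hV : ∀ p ∈ a.vars,
            a.finite_vars.toFinset.inf
              (fun p => Opens.of (isoTheory T) (.iso 0 p.1 (y p) p.2)) ≤
            Opens.of (isoTheory T) (.iso 0 p.1 (y' p) p.2) := fun p hp => by
          rw [h hp]
          exact Finset.inf_le (a.finite_vars.mem_toFinset.2 hp)
        cases a with
        | eqv X n m =>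
          refine le_trans (le_inf (le_inf ?_ ?_) inf_le_left)
            (hα.inj X (y' (X, n)) (y' (X, m)) n m)
          · exact inf_le_right.trans (hV (X, n) (Or.inl rfl))
          · exact inf_le_right.trans (hV (X, m) (Or.inr rfl))
        | rel R n =>
          refine le_trans (le_inf (inf_le_right.trans ?_) inf_le_left)
            (hα.refl R (fun i => y' (T.sig.dom R i, n i)) n)
          exact Finset.le_inf fun i _ => hV (T.sig.dom R i, n i) ⟨i, rfl⟩
  · obtain rfl := Subsingleton.elim j 0
    -- Here `α(n) = m` and `α(y(X, m)) = m`, so injectivity gives `n ∼ y(X, m)`, the inverse image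
    -- of `[α(n) = m]` along the section.
    refine ⟨{(X, m)}, ?_, fun y y' hy' h => ?_⟩
    · intro p hp
      rw [Finset.mem_singleton] at hp
      subst hp
      exact hα.cod_le X n m
    · rw [reindexHom_iso, copyHom_of, h (by simp), Finset.inf_singleton]
      refine le_trans (le_inf le_rfl (inf_le_left.trans (hα.cod_le X n m))) 
        (hα.inj X n (y (X, m)) m m)

/-- This is the unit of the adjunction. A finite meet of basic propositions is covered by the pieces
on which a function `y` chooses preimages of all codomain elements mentioned; on each piece a single
section already suffices. -/
theorem le_sourceHom_sourceImage (z : Opens (isoTheory T)) :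
    z ≤ sourceHom T (sourceImage T z) := by
  classical
  conv_lhs => rw [Opens.eq_iSup_inf_of z]
  refine iSup₂_le fun F hF => ?_
  have hFz : F.inf (Opens.of (isoTheory T)) ≤ z := by
    conv_rhs => rw [Opens.eq_iSup_inf_of z]
    exact le_iSup₂_of_le F hF le_rfl
  refine le_trans ?_ (OrderHomClass.mono (sourceHom T) (sourceImage_mono T hFz))
  choose V hdef himg using exists_finite_codomain T
  have hα := (Opens.isModel_of (isoTheory T)).isIsoRel 0
  let W := F.biUnion V
  -- Each element of `W` is defined on this meet, so surjectivity of `α` gives it a preimage;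
  -- distributing the finite meet over these joins collects the choices into one function `y`.
  have hW : F.inf (Opens.of (isoTheory T)) ≤
      ⨆ y : T.sig.Sorts × ℕ → ℕ, W.inf fun p =>
        Opens.of (isoTheory T) (.iso 0 p.1 (y p) p.2) := by
    refine le_trans ?_ (finset_inf_iSup_le_iSup_inf
      (fun (p : T.sig.Sorts × ℕ) (m : ℕ) => Opens.of (isoTheory T) (.iso 0 p.1 m p.2)) W)
    refine Finset.le_inf fun p hp => ?_
    obtain ⟨a, ha, hp⟩ := Finset.mem_biUnion.1 hp
    exact (Finset.inf_le ha).trans ((hdef a p hp).trans (hα.surj p.1 p.2))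
  refine (le_inf le_rfl hW).trans ?_
  rw [inf_iSup_eq]
  refine iSup_le fun y => ?_
  -- The chosen `y` is arbitrary outside `W`; it is altered there to give a section.
  obtain ⟨y', hy', h⟩ := exists_sortwiseSurjective_eqOn W.finite_toSet y
  refine le_trans ?_ (OrderHomClass.mono (sourceHom T) (le_iSup (fun y : {y : T.sig.Sorts × ℕ → ℕ //
    SortwiseSurjective y} => reindexHom T y.1 y.2 (F.inf (Opens.of (isoTheory T)))) ⟨y', hy'⟩))
  rw [map_finset_inf, map_finset_inf]
  refine Finset.le_inf fun a ha => ?_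
  have hsub : V a ⊆ W := Finset.subset_biUnion_of_mem V ha
  exact (inf_le_inf (Finset.inf_le ha) (Finset.inf_mono hsub)).trans
    (himg a y y' hy' (h.mono (Finset.coe_subset.2 hsub)))

theorem sourceImage_gc : GaloisConnection (sourceImage T) (sourceHom T) := fun z x =>
  ⟨fun h => (le_sourceHom_sourceImage T z).trans (OrderHomClass.mono (sourceHom T) h),
    fun h => (sourceImage_mono T h).trans
      (iSup_le fun y => (reindexHom_sourceHom y.2 x).le)⟩

end SourceAdjoint

/-! ### The groupoid laws -/

section GroupoidLaws

theorem inverseImage_injective {X Y : Locale.{u}} {f g : X ⟶ Y}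
    (h : inverseImage f = inverseImage g) : f = g :=
  Quiver.Hom.unop_inj (Frm.hom_ext h)

variable {T : Theory.{u}}

theorem localeMap_ext {W : Locale.{u}} {f g : W ⟶ Locale.of (Opens T)}
    (h : ∀ a, inverseImage f (Opens.of T a) = inverseImage g (Opens.of T a)) : f = g :=
  inverseImage_injective (Opens.hom_ext h)

/-- The model `g` is the image of the universal model in `Opens T`, so its image under `f` is that
of the universal model under a composite homomorphism, which preserves the evaluation of both sides
of each axiom. -/
theorem IsModel.map {L : Type v} [Order.Frame L] {M : Type w} [Order.Frame M]
    {g : Basic T.sig → L} (h : IsModel T g) (f : FrameHom L M) : IsModel T fun a => f (g a) := by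
  have he : (fun a => f (g a)) = fun a => f.comp (Opens.lift g h) (Opens.of T a) := by
    funext a
    rw [FrameHom.comp_apply, Opens.lift_of]
  rw [he]
  intro a b hab
  generalize f.comp (Opens.lift g h) = F at hab
  have hO := Opens.isModel_of T
  cases hab with
  | symm X n m => exact OrderHomClass.mono F (hO _ _ (.symm X n m))
  | trans X n m l =>
    rw [← map_inf]
    exact OrderHomClass.mono F (hO _ _ (.trans X n m l))
  | congr R n m =>
    rw [← map_eqvAll, ← map_inf]
    exact OrderHomClass.mono F (hO _ _ (.congr R n m))
  | strict R n =>
    rw [← map_eqvAll]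
    exact OrderHomClass.mono F (hO _ _ (.strict R n))
  | ax σ hσ n =>
    rw [← map_eqvAll, ← Formula.map_eval, ← Formula.map_eval, ← map_inf]
    exact OrderHomClass.mono F (hO _ _ (.ax σ hσ n))

/-- The frame map out of the theory of composable pairs that corresponds to a composable pair of
isomorphisms. -/
noncomputable def pairHom {L : Type v} [Order.Frame L] (f g : FrameHom (Opens (isoTheory T)) L)
    (h : ∀ x, f (targetHom T x) = g (sourceHom T x)) :
    FrameHom (Opens (isoPairTheory T)) L :=
  Opens.lift (T := isoPairTheory T)
    (Basic.glue ![fun a => f (Opens.of (isoTheory T) (a.copy 0)),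
        fun a => f (Opens.of (isoTheory T) (a.copy 1)),
        fun a => g (Opens.of (isoTheory T) (a.copy 1))]
      ![fun X n m => f (Opens.of (isoTheory T) (.iso 0 X n m)),
        fun X n m => g (Opens.of (isoTheory T) (.iso 0 X n m))])
    (isModel_glue
      (fun i => by
        have hf := (Opens.isModel_of (isoTheory T)).map f
        have hg := (Opens.isModel_of (isoTheory T)).map g
        fin_cases i
        · exact hf.copy (0 : Fin 2)
        · exact hf.copy (1 : Fin 2)
        · exact hg.copy (1 : Fin 2))
      (fun j => by
        have hf := ((Opens.isModel_of (isoTheory T)).map f).isIsoRel 0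
        have hg := ((Opens.isModel_of (isoTheory T)).map g).isIsoRel 0
        fin_cases j
        · exact hf
        -- The middle model is recorded as the target of `f`, whereas `g` is an isomorphism out of
        -- its own source; composability identifies the two.
        · have e : (fun a : Basic T.sig => f (Opens.of (isoTheory T) (a.copy 1))) =
              fun a => g (Opens.of (isoTheory T) (a.copy 0)) := by
            funext a
            rw [← copyHom_of, ← copyHom_of, h]
          change IsIsoRel (fun a : Basic T.sig => f (Opens.of (isoTheory T) (a.copy 1))) _ _
          rw [e]
          exact hg))

section

variable {L : Type v} [Order.Frame L] {f g : FrameHom (Opens (isoTheory T)) L}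
  (h : ∀ x, f (targetHom T x) = g (sourceHom T x))

theorem pairHom_projHom_zero : (pairHom f g h).comp (projHom T 0) = f := by
  refine Opens.chain_hom_ext (fun i a => ?_) (fun j X n m => ?_)
  · rw [FrameHom.comp_apply, projHom_copy]
    refine ((Opens.lift_of _ _ _).trans (Basic.glue_copy _ _ _ _)).trans ?_
    fin_cases i <;> rfl
  · rw [FrameHom.comp_apply, projHom_iso]
    obtain rfl := Subsingleton.elim j 0
    exact (Opens.lift_of _ _ _).trans (Basic.glue_iso _ _ _ _ _ _)

theorem pairHom_projHom_one : (pairHom f g h).comp (projHom T 1) = g := by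
  refine Opens.chain_hom_ext (fun i a => ?_) (fun j X n m => ?_)
  · rw [FrameHom.comp_apply, projHom_copy]
    refine ((Opens.lift_of _ _ _).trans (Basic.glue_copy _ _ _ _)).trans ?_
    fin_cases i
    · change f (Opens.of (isoTheory T) (a.copy 1)) = g (Opens.of (isoTheory T) (a.copy 0))
      rw [← copyHom_of, ← copyHom_of, h]
    · rfl
  · rw [FrameHom.comp_apply, projHom_iso]
    obtain rfl := Subsingleton.elim j 0
    exact (Opens.lift_of _ _ _).trans (Basic.glue_iso _ _ _ _ _ _)

/-- Every generator is in the image of a projection: copies `0` and `1` and the first isomorphism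
come from `projHom T 0`, copy `2` and the second isomorphism from `projHom T 1`. -/
theorem pair_hom_ext {f f' : FrameHom (Opens (isoPairTheory T)) L}
    (h₁ : f.comp (projHom T 0) = f'.comp (projHom T 0))
    (h₂ : f.comp (projHom T 1) = f'.comp (projHom T 1)) : f = f' := by
  have e₁ := fun (i : Fin 2) (a : Basic T.sig) =>
    DFunLike.congr_fun h₁ (Opens.of (isoTheory T) (a.copy i))
  have e₂ := fun (i : Fin 2) (a : Basic T.sig) =>
    DFunLike.congr_fun h₂ (Opens.of (isoTheory T) (a.copy i))
  have d₁ := fun X n m => DFunLike.congr_fun h₁ (Opens.of (isoTheory T) (.iso 0 X n m))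
  have d₂ := fun X n m => DFunLike.congr_fun h₂ (Opens.of (isoTheory T) (.iso 0 X n m))
  simp only [FrameHom.comp_apply, projHom_copy, projHom_iso] at e₁ e₂ d₁ d₂
  refine Opens.chain_hom_ext (fun i a => ?_) (fun j X n m => ?_)
  · fin_cases i
    · exact e₁ 0 a
    · exact e₁ 1 a
    · exact e₂ 1 a
  · fin_cases j
    · exact d₁ X n m
    · exact d₂ X n m

end

variable (T)

theorem representingGroupoid_isPullback :
    IsPullback (representingGroupoid T).π₁ (representingGroupoid T).π₂
      (representingGroupoid T).t (representingGroupoid T).s := by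
  have w : (representingGroupoid T).π₁ ≫ (representingGroupoid T).t =
      (representingGroupoid T).π₂ ≫ (representingGroupoid T).s := localeMap_ext fun a => by
    change projHom T 0 (targetHom T (Opens.of T a)) = projHom T 1 (sourceHom T (Opens.of T a))
    rw [copyHom_of, copyHom_of, projHom_copy, projHom_copy]
    rfl
  have hc : ∀ s : Limits.PullbackCone (representingGroupoid T).t (representingGroupoid T).s,
      ∀ x, inverseImage s.fst (targetHom T x) = inverseImage s.snd (sourceHom T x) := fun s =>
    DFunLike.congr_fun (congrArg inverseImage s.condition)
  refine ⟨⟨w⟩, ⟨Limits.PullbackCone.IsLimit.mk w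
    (fun s => localeMap (pairHom (inverseImage s.fst) (inverseImage s.snd) (hc s))) ?_ ?_ ?_⟩⟩
  · exact fun s => inverseImage_injective (pairHom_projHom_zero (hc s))
  · exact fun s => inverseImage_injective (pairHom_projHom_one (hc s))
  · intro s m h₁ h₂
    refine inverseImage_injective (pair_hom_ext ?_ ?_)
    · exact (congrArg inverseImage h₁).trans (pairHom_projHom_zero (hc s)).symm
    · exact (congrArg inverseImage h₂).trans (pairHom_projHom_one (hc s)).symm

/-! ### Inversion, composition and the laws -/

theorem inversionHom_inversionHom (z : Opens (isoTheory T)) :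
    inversionHom T (inversionHom T z) = z := by
  have : (inversionHom T).comp (inversionHom T) = FrameHom.id _ :=
    Opens.chain_hom_ext
      (fun i a => by
        rw [FrameHom.comp_apply, inversionHom_copy, inversionHom_copy, Fin.rev_rev,
          FrameHom.id_apply])
      (fun j X n m => by
        obtain rfl := Subsingleton.elim j 0
        rw [FrameHom.comp_apply, inversionHom_iso, inversionHom_iso, FrameHom.id_apply])
  exact DFunLike.congr_fun this z

theorem inversionHom_copyHom (i : Fin 2) (x : Opens T) :
    inversionHom T (copyHom T 1 i x) = copyHom T 1 i.rev x := by
  have : (inversionHom T).comp (copyHom T 1 i) = copyHom T 1 i.rev :=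
    Opens.hom_ext fun a => by
      rw [FrameHom.comp_apply, copyHom_of, inversionHom_copy, copyHom_of]
  exact DFunLike.congr_fun this x

section

variable {L : Type u} [Order.Frame L]

theorem hom_compositionHom_iso (p : FrameHom (Opens (isoPairTheory T)) L) (j : Fin 1)
    (X : T.sig.Sorts) (n m : ℕ) :
    p (compositionHom T (Opens.of (isoTheory T) (.iso j X n m))) =
      ⨆ l, p (projHom T 0 (Opens.of (isoTheory T) (.iso 0 X n l))) ⊓
        p (projHom T 1 (Opens.of (isoTheory T) (.iso 0 X l m))) := by
  simp only [compositionHom_iso, projHom_iso, map_iSup, map_inf]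

theorem compositionHom_copy_zero (a : Basic T.sig) :
    compositionHom T (Opens.of (isoTheory T) (a.copy 0)) =
      projHom T 0 (Opens.of (isoTheory T) (a.copy 0)) := by
  rw [compositionHom_copy, projHom_copy]
  rfl

theorem compositionHom_copy_one (a : Basic T.sig) :
    compositionHom T (Opens.of (isoTheory T) (a.copy 1)) =
      projHom T 1 (Opens.of (isoTheory T) (a.copy 1)) := by
  rw [compositionHom_copy, projHom_copy]
  rfl

/-- To identify the composite of a composable pair, it suffices to identify its source, its target
and its graph. -/
theorem comp_compositionHom_eq {p : FrameHom (Opens (isoPairTheory T)) L}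
    {f g c : FrameHom (Opens (isoTheory T)) L} (h₁ : ∀ z, p (projHom T 0 z) = f z)
    (h₂ : ∀ z, p (projHom T 1 z) = g z)
    (hs : ∀ a : Basic T.sig, f (Opens.of (isoTheory T) (a.copy 0)) =
      c (Opens.of (isoTheory T) (a.copy 0)))
    (ht : ∀ a : Basic T.sig, g (Opens.of (isoTheory T) (a.copy 1)) =
      c (Opens.of (isoTheory T) (a.copy 1)))
    (hα : ∀ X n m, ⨆ l, f (Opens.of (isoTheory T) (.iso 0 X n l)) ⊓
        g (Opens.of (isoTheory T) (.iso 0 X l m)) = c (Opens.of (isoTheory T) (.iso 0 X n m))) :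
    p.comp (compositionHom T) = c := by
  refine Opens.chain_hom_ext (fun i a => ?_) (fun j X n m => ?_)
  · fin_cases i
    · refine (congrArg p (compositionHom_copy_zero T a)).trans ((h₁ _).trans (hs a))
    · refine (congrArg p (compositionHom_copy_one T a)).trans ((h₂ _).trans (ht a))
  · obtain rfl := Subsingleton.elim j 0
    rw [FrameHom.comp_apply, hom_compositionHom_iso, ← hα]
    simp only [h₁, h₂]

theorem comp_compositionHom_assoc {p q a b : FrameHom (Opens (isoPairTheory T)) L}
    (hpq : ∀ z, p (projHom T 1 z) = q (projHom T 0 z))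
    (ha₁ : ∀ z, a (projHom T 0 z) = p (compositionHom T z))
    (ha₂ : ∀ z, a (projHom T 1 z) = q (projHom T 1 z))
    (hb₁ : ∀ z, b (projHom T 0 z) = p (projHom T 0 z))
    (hb₂ : ∀ z, b (projHom T 1 z) = q (compositionHom T z)) :
    a.comp (compositionHom T) = b.comp (compositionHom T) := by
  refine comp_compositionHom_eq T (f := p.comp (compositionHom T)) (g := q.comp (projHom T 1))
    ha₁ ha₂ (fun c => ?_) (fun c => ?_) fun X n m => ?_
  · simp only [FrameHom.comp_apply, compositionHom_copy_zero, hb₁]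
  · simp only [FrameHom.comp_apply, compositionHom_copy_one, hb₂]
  · simp only [FrameHom.comp_apply, hom_compositionHom_iso, hb₁, hb₂, hpq, iSup_inf_eq,
      inf_iSup_eq, inf_assoc]
    -- Both graphs are joins over the two intermediate elements of the same triple meet; only the
    -- order of the joins differs.
    exact iSup_comm

end

theorem representingGroupoid_isLocalicGroupoid :
    (representingGroupoid T).IsLocalicGroupoid := by
  have hM := Opens.isModel_of (isoTheory T)
  have hα := hM.isIsoRel 0
  have hsymm : ∀ (i : Fin 2) X n m, Opens.of (isoTheory T) ((Basic.eqv X n m).copy i) ≤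
      Opens.of (isoTheory T) ((Basic.eqv X m n).copy i) := fun i X n m =>
    hM.copy i _ _ (.symm X n m)
  refine
    { isPullback := representingGroupoid_isPullback T
      e_s := localeMap_ext fun a => ?_
      e_t := localeMap_ext fun a => ?_
      m_s := localeMap_ext fun a => ?_
      m_t := localeMap_ext fun a => ?_
      assoc := ?_
      e_comp := fun p h₁ h₂ => inverseImage_injective (comp_compositionHom_eq T
        (DFunLike.congr_fun (congrArg inverseImage h₁))
        (DFunLike.congr_fun (congrArg inverseImage h₂))
        (fun a => ?_) (fun a => rfl) fun X n m => ?_)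
      comp_e := fun p h₁ h₂ => inverseImage_injective (comp_compositionHom_eq T
        (DFunLike.congr_fun (congrArg inverseImage h₁))
        (DFunLike.congr_fun (congrArg inverseImage h₂))
        (fun a => rfl) (fun a => ?_) fun X n m => ?_)
      i_s := inverseImage_injective (DFunLike.ext _ _ (inversionHom_copyHom T 0))
      i_t := inverseImage_injective (DFunLike.ext _ _ (inversionHom_copyHom T 1))
      comp_i := fun p h₁ h₂ => inverseImage_injective (comp_compositionHom_eq T
        (DFunLike.congr_fun (congrArg inverseImage h₁))
        (DFunLike.congr_fun (congrArg inverseImage h₂))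
        (fun a => ?_) (fun a => ?_) fun X n m => ?_)
      i_comp := fun p h₁ h₂ => inverseImage_injective (comp_compositionHom_eq T
        (DFunLike.congr_fun (congrArg inverseImage h₁))
        (DFunLike.congr_fun (congrArg inverseImage h₂))
        (fun a => ?_) (fun a => ?_) fun X n m => ?_)
      i_i := inverseImage_injective (DFunLike.ext _ _ (inversionHom_inversionHom T)) }
  · change identityHom T (sourceHom T (Opens.of T a)) = Opens.of T a
    rw [copyHom_of, identityHom_copy]
  · change identityHom T (targetHom T (Opens.of T a)) = Opens.of T a
    rw [copyHom_of, identityHom_copy]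
  · change compositionHom T (sourceHom T (Opens.of T a)) = projHom T 0 (sourceHom T (Opens.of T a))
    rw [copyHom_of, compositionHom_copy_zero]
  · change compositionHom T (targetHom T (Opens.of T a)) = projHom T 1 (targetHom T (Opens.of T a))
    rw [copyHom_of, compositionHom_copy_one]
  · intro W p q a b hpq ha₁ ha₂ hb₁ hb₂
    exact inverseImage_injective (comp_compositionHom_assoc T
      (DFunLike.congr_fun (congrArg inverseImage hpq))
      (DFunLike.congr_fun (congrArg inverseImage ha₁))
      (DFunLike.congr_fun (congrArg inverseImage ha₂))
      (DFunLike.congr_fun (congrArg inverseImage hb₁))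
      (DFunLike.congr_fun (congrArg inverseImage hb₂)))
  · change sourceHom T (identityHom T _) = _
    rw [identityHom_copy, copyHom_of]
    rfl
  · change ⨆ l, sourceHom T (identityHom T (Opens.of (isoTheory T) (.iso 0 X n l))) ⊓
      Opens.of (isoTheory T) (.iso 0 X l m) = Opens.of (isoTheory T) (.iso 0 X n m)
    simp only [identityHom_iso, copyHom_of]
    -- From `n ∼ l` and `α(l) = m` congruence gives `α(n) = m`; conversely `l = n` serves, since `n`
    -- is defined.
    apply le_antisymm
    · refine iSup_le fun l => le_trans (le_inf (le_inf inf_le_right ?_) ?_) (hα.congr X l m n m)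
      · exact inf_le_left.trans (hsymm 0 X n l)
      · exact inf_le_right.trans (hα.cod_le X l m)
    · exact le_iSup_of_le n (le_inf (hα.dom_le X n m) le_rfl)
  · change targetHom T (identityHom T _) = _
    rw [identityHom_copy, copyHom_of]
    rfl
  · change ⨆ l, Opens.of (isoTheory T) (.iso 0 X n l) ⊓
      targetHom T (identityHom T (Opens.of (isoTheory T) (.iso 0 X l m))) =
        Opens.of (isoTheory T) (.iso 0 X n m)
    simp only [identityHom_iso, copyHom_of]
    apply le_antisymm
    · refine iSup_le fun l => le_trans (le_inf (le_inf inf_le_left ?_) inf_le_right)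
        (hα.congr X n l n m)
      exact inf_le_left.trans (hα.dom_le X n l)
    · exact le_iSup_of_le m (le_inf le_rfl (hα.cod_le X n m))
  · change Opens.of (isoTheory T) (a.copy 0) =
      sourceHom T (identityHom T (Opens.of (isoTheory T) (a.copy 0)))
    rw [identityHom_copy, copyHom_of]
  · change inversionHom T (Opens.of (isoTheory T) (a.copy 1)) =
      sourceHom T (identityHom T (Opens.of (isoTheory T) (a.copy 1)))
    rw [identityHom_copy, copyHom_of, inversionHom_copy]
    rfl
  · change ⨆ l, Opens.of (isoTheory T) (.iso 0 X n l) ⊓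
      inversionHom T (Opens.of (isoTheory T) (.iso 0 X l m)) =
        sourceHom T (identityHom T (Opens.of (isoTheory T) (.iso 0 X n m)))
    simp only [identityHom_iso, copyHom_of, inversionHom_iso]
    -- From `α(n) = l` and `α(m) = l` injectivity gives `n ∼ m`. Conversely `n` is defined, totality
    -- supplies `l` with `α(n) = l`, and congruence along `n ∼ m` gives `α(m) = l`.
    apply le_antisymm
    · exact iSup_le fun l => le_trans (le_inf le_rfl (inf_le_left.trans (hα.cod_le X n l)))
        (hα.inj X n m l l)
    · refine (le_inf le_rfl (((IsIsoRel.id (hM.copy (0 : Fin 2))).dom_le X n m).trans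
        (hα.total X n))).trans ?_
      rw [inf_iSup_eq]
      refine iSup_mono fun l => le_inf inf_le_right ?_
      refine le_trans (le_inf (le_inf inf_le_right inf_le_left) ?_) (hα.congr X n l m l)
      exact inf_le_right.trans (hα.cod_le X n l)
  · change inversionHom T (Opens.of (isoTheory T) (a.copy 0)) =
      targetHom T (identityHom T (Opens.of (isoTheory T) (a.copy 0)))
    rw [identityHom_copy, copyHom_of, inversionHom_copy]
    rfl
  · change Opens.of (isoTheory T) (a.copy 1) =
      targetHom T (identityHom T (Opens.of (isoTheory T) (a.copy 1)))
    rw [identityHom_copy, copyHom_of]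
  · change ⨆ l, inversionHom T (Opens.of (isoTheory T) (.iso 0 X n l)) ⊓
      Opens.of (isoTheory T) (.iso 0 X l m) =
        targetHom T (identityHom T (Opens.of (isoTheory T) (.iso 0 X n m)))
    simp only [identityHom_iso, copyHom_of, inversionHom_iso]
    -- The mirror image of the previous law, with functionality and surjectivity of `α` in place of
    -- injectivity and totality.
    apply le_antisymm
    · exact iSup_le fun l => le_trans (le_inf le_rfl (inf_le_left.trans (hα.dom_le X l n)))
        (hα.func X l l n m)
    · refine (le_inf le_rfl (((IsIsoRel.id (hM.copy (1 : Fin 2))).dom_le X n m).trans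
        (hα.surj X n))).trans ?_
      rw [inf_iSup_eq]
      refine iSup_mono fun l => le_inf inf_le_right ?_
      refine le_trans (le_inf (le_inf inf_le_right ?_) inf_le_left) (hα.congr X l n l m)
      exact inf_le_right.trans (hα.dom_le X l n)

/-- Since `t^* = i^* s^*` and `i^*` is its own inverse, hence its own adjoint, the left adjoint of
`t^*` is `s_! i^*`. -/
theorem targetImage_gc :
    GaloisConnection (fun z => sourceImage T (inversionHom T z)) (targetHom T) := fun z x => by
  refine (sourceImage_gc T _ _).trans ⟨fun h => ?_, fun h => ?_⟩
  · have h' := OrderHomClass.mono (inversionHom T) h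
    rwa [inversionHom_inversionHom, inversionHom_copyHom] at h'
  · have h' := OrderHomClass.mono (inversionHom T) h
    rwa [inversionHom_copyHom] at h'

theorem targetImage_frobenius (x : Opens T) (z : Opens (isoTheory T)) :
    sourceImage T (inversionHom T (targetHom T x ⊓ z)) =
      x ⊓ sourceImage T (inversionHom T z) := by
  rw [map_inf, inversionHom_copyHom]
  exact sourceImage_frobenius T x _

theorem representingGroupoid_isOpenLocalicGroupoid :
    (representingGroupoid T).IsOpenLocalicGroupoid where
  toIsLocalicGroupoid := representingGroupoid_isLocalicGroupoid T
  s_open := ⟨sourceImage T, sourceImage_gc T, sourceImage_frobenius T⟩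
  t_open := ⟨_, targetImage_gc T, targetImage_frobenius T⟩

end GroupoidLaws

end GeomRep

/-- The localic groupoid `G^T` of a geometric theory `T` is an open localic groupoid, and the left
adjoint of the inverse image of its source map is given on basic opens by the explicit formula and
satisfies Frobenius reciprocity. -/
theorem mainTheorem4 (T : GeomRep.Theory.{u}) :
    (GeomRep.representingGroupoid T).IsOpenLocalicGroupoid ∧
    ∃ s_shriek : GeomRep.Opens (GeomRep.isoTheory T) → GeomRep.Opens T,
      GaloisConnection s_shriek (GeomRep.sourceHom T) ∧
      (∀ (x : GeomRep.Opens T) (z : GeomRep.Opens (GeomRep.isoTheory T)),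
        s_shriek (GeomRep.sourceHom T x ⊓ z) = x ⊓ s_shriek z) ∧
      ∀ (I J : Finset (GeomRep.Basic T.sig)) (K : Finset (T.sig.Sorts × ℕ × ℕ)),
        s_shriek (GeomRep.basicOpen T I J K) = GeomRep.basicImage T I J K := by
  exact ⟨GeomRep.representingGroupoid_isOpenLocalicGroupoid T, GeomRep.sourceImage T,
    GeomRep.sourceImage_gc T, GeomRep.sourceImage_frobenius T, GeomRep.sourceImage_basicOpen T⟩
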